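/- Let $n\ge 0$ be an integer. Let $$\mathtt V_n=\{(x_1,x_2)\in\mathbb Z^2: 0\le x_1\le 2n,\ x_1\le x_2\le 2n+1\},$$ with the point $(2n,2n+1)$ removed if $n$ is odd, and let $\mathbf b=(2n,\,2n+1-[n]_2)\in\mathtt V_n$, where $[m]_2\in\{0,1\}$ is the residue of $m$ modulo $2$. For $x,y\in\mathtt V_n$ put $k_n(x,y)=1$ if * $[x_1+x_2]_2=0$, $x_2=y_2$ and $x_1-y_1=1$, or * $[x_1+x_2]_2=0$, $|x_2-y_2|=1$ and $x_1=y_1$, or * $x_1=x_2$ and $y_1=y_2=x_1-1$, and $k_n(x,y)=0$ otherwise. Let $K_n(x,y)=k_n(x,y)-k_n(y,x)$. This is the skew-symmetric Kasteleyn matrix of the TSSCPP graph $G_n$, whose vertex set is $\mathtt V_n$ and whose edges are the pairs $\{x,y\}$ with $K_n(x,y)\ne0$. Write $C_m=\frac1{m+1}\binom{2m}{m}$ and, for $0\le \ell\le k\le n$, $$p(n,k,\ell)=\frac{(n+k-2\ell+1)!\,(2n-k-\ell+1)!}{(k-\ell)!\,(3n-k+2-2\ell)!}(-1)^k(3n-3k+2)\,C_{n-k}.$$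 Let $\Gamma_0$ be a positively oriented circle around $0$ of any radius $\rho\in(0,1)$. For $0\le k\le n$ and $i\ge0$ put $$\phi^0_{k,i}(r)=\frac{(1+r)^{n-k}}{(1-r)\,r^{i-2k}},\qquad \phi^1_{k,i}(r)=\frac{(1+r)^{n-k}}{r^{i-2k+1}},$$ $$h_n^{0,\mathbf b}(i)=-[i+1]_2+\sum_{k=0}^n p(n,k,0)\frac1{2\pi\mathrm i}\int_{\Gamma_0}\phi^0_{k,i}(r)\,dr,\qquad h_n^{1,\mathbf b}(i)=\sum_{k=0}^n p(n,k,0)\frac1{2\pi\mathrm i}\int_{\Gamma_0}\phi^1_{k,i}(r)\,dr,$$ and, for $\epsilon,\epsilon'\in\{0,1\}$ and $i,j\ge0$, $$Q_n^{\epsilon,\epsilon'}(i,j)=\sum_{k_1=0}^n\sum_{\ell_1=0}^{k_1}\sum_{k_2=0}^n\sum_{\ell_2=0}^{k_2}\frac{p(n,k_1,\ell_1)\,p(n,k_2,\ell_2)}{(2\pi\mathrm i)^4}\int_{\Gamma_0}\!dr_1\int_{\Gamma_0}\!dr_2\int_{\Gamma_0}\!ds_1\int_{\Gamma_0}\!ds_2\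 \phi^{\epsilon}_{k_1,i}(r_1)\,\phi^{\epsilon'}_{k_2,j}(r_2)\,\frac{s_1-s_2}{(s_1s_2-1)\,s_1^{\ell_1+1}s_2^{\ell_2+1}}.$$ Define the four kernels $$t_n^{0,0}(i,j)=\mathbf 1_{i<j}[i+1]_2[j]_2-\mathbf 1_{i>j}[i]_2[j+1]_2+[j+1]_2h_n^{0,\mathbf b}(i)-[i+1]_2h_n^{0,\mathbf b}(j)+Q_n^{0,0}(i,j),$$ $$t_n^{1,0}(i,j)=[j+1]_2h_n^{1,\mathbf b}(i)+Q_n^{1,0}(i,j),\qquad t_n^{0,1}(i,j)=-[i+1]_2h_n^{1,\mathbf b}(j)+Q_n^{0,1}(i,j),\qquad t_n^{1,1}(i,j)=Q_n^{1,1}(i,j).$$ Below, $\binom{m}{\ell}=m(m-1)\cdots(m-\ell+1)/\ell!$ for every integer $m$ and every integer $\ell\ge 0$; in particular $\binom{-1}{0}=1$. **Theorem.** The matrix $K_n$ is invertible, $K_n^{-1}(y,x)=-K_n^{-1}(x,y)$ for all $x,y\in\mathtt V_n$, and the entries of $K_n^{-1}$ are given as follows. Let $x=(i_1,i_1+2i_2+\epsilon_i)$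 and $y=(j_1,j_1+2j_2+\epsilon_j)$ with $0\le i_1,j_1\le 2n-1$, $\epsilon_i,\epsilon_j\in\{0,1\}$, $0\le i_2\le n-\lfloor (i_1+\epsilon_i)/2\rfloor$ and $0\le j_2\le n-\lfloor (j_1+\epsilon_j)/2\rfloor$. (These are exactly the vertices with first coordinate at most $2n-1$.) 1. If $\epsilon_i=\epsilon_j=1$, then $$K_n^{-1}(x,y)=\sum_{\ell_1=0}^{i_1}\sum_{\ell_2=0}^{j_1}(-1)^{i_2+j_2}(-1)^{\ell_1+\ell_2}\binom{i_2-1+\ell_1}{\ell_1}\binom{j_2-1+\ell_2}{\ell_2}\,t_n^{1,1}(i_1-\ell_1,j_1-\ell_2).$$ 2. If $\epsilon_i=\epsilon_j=0$, then $$K_n^{-1}(x,y)=\sum_{\ell_1=0}^{i_2}\sum_{\ell_2=0}^{j_2}(-1)^{i_2+j_2}\binom{i_2}{\ell_1}\binom{j_2}{\ell_2}\,t_n^{0,0}(i_1+\ell_1,j_1+\ell_2).$$ 3. If $\epsilon_i=1$ and $\epsilon_j=0$, then $$K_n^{-1}(x,y)=\sum_{\ell_1=0}^{i_1}\sum_{\ell_2=0}^{j_2}(-1)^{i_2+j_2}(-1)^{\ell_1}\binom{i_2-1+\ell_1}{\ell_1}\binom{j_2}{\ell_2}\,t_n^{1,0}(i_1-\ell_1,j_1+\ell_2)-(-1)^{i_2+j_2}\,\mathbf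 1_{x_1\ge y_1}\mathbf 1_{x_1+x_2<y_1+y_2}\binom{j_2-i_2-1}{i_1-j_1}.$$ 4. If $\epsilon_i=0$ and $\epsilon_j=1$, then $$K_n^{-1}(x,y)=\sum_{\ell_1=0}^{i_2}\sum_{\ell_2=0}^{j_1}(-1)^{i_2+j_2}(-1)^{\ell_2}\binom{i_2}{\ell_1}\binom{j_2-1+\ell_2}{\ell_2}\,t_n^{0,1}(i_1+\ell_1,j_1-\ell_2)+(-1)^{i_2+j_2}\,\mathbf 1_{y_1\ge x_1}\mathbf 1_{y_1+y_2<x_1+x_2}\binom{i_2-j_2-1}{j_1-i_1}.$$ The entries with a vertex of first coordinate $2n$ are, up to antisymmetry, the following. For $x$ as above, $$K_n^{-1}(x,\mathbf b)=\sum_{\ell=0}^{i_1}(-1)^{i_2+\ell}\binom{i_2-1+\ell}{\ell}h_n^{1,\mathbf b}(i_1-\ell)\quad(\epsilon_i=1),\qquad K_n^{-1}(x,\mathbf b)=\sum_{\ell=0}^{i_2}(-1)^{i_2}\binom{i_2}{\ell}h_n^{0,\mathbf b}(i_1+\ell)\quad(\epsilon_i=0).$$ If $n$ is even, then $K_n^{-1}((2n,2n),\mathbf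 b)=-1$ and $K_n^{-1}((2n,2n),y)=0$ for every $y\in\mathtt V_n$ with $y\ne\mathbf b$. -/

import Mathlib

open scoped Nat

noncomputable section

namespace TSSCPP

/-- The vertices of `G_n`: pairs `(x₁, x₂)` with `0 ≤ x₁ ≤ 2n` and `x₁ ≤ x₂ ≤ 2n + 1`,
the vertex `(2n, 2n + 1)` being removed if `n` is odd. -/
def vertices (n : ℕ) : Finset (ℕ × ℕ) :=
  (Finset.range (2 * n + 1) ×ˢ Finset.range (2 * n + 2)).filter
    (fun x => x.1 ≤ x.2 ∧ ¬ (Odd n ∧ x = (2 * n, 2 * n + 1)))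

/-- The vertex `𝐛 = (2n, 2n + 1 - [n]₂)`. -/
def b (n : ℕ) : vertices n :=
  ⟨(2 * n, 2 * n + 1 - n % 2), by
    simp only [vertices, Finset.mem_filter, Finset.mem_product, Finset.mem_range, Prod.mk.injEq,
      Nat.odd_iff]
    omega⟩

/-- The upper half `k_n` of the Kasteleyn matrix, that is, the indicator of an oriented edge. -/
def k (x y : ℕ × ℕ) : ℂ :=
  if (x.1 + x.2) % 2 = 0 ∧ x.2 = y.2 ∧ x.1 = y.1 + 1 then 1
  else if (x.1 + x.2) % 2 = 0 ∧ (y.2 = x.2 + 1 ∨ x.2 = y.2 + 1) ∧ x.1 = y.1 then 1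
  else if x.1 = x.2 ∧ y.1 = y.2 ∧ x.1 = y.1 + 1 then 1
  else 0

/-- The skew-symmetric Kasteleyn matrix `K_n` of `G_n`, indexed by the vertices of `G_n`. -/
def K (n : ℕ) : Matrix (vertices n) (vertices n) ℂ :=
  Matrix.of fun x y => k x.1 y.1 - k y.1 x.1

/-- The weights `p(n, k, ℓ)`; they are used for `ℓ ≤ k ≤ n` only, where no natural-number
subtraction truncates. -/
def p (n k l : ℕ) : ℂ :=
  ((n + k + 1 - 2 * l)! * (2 * n + 1 - k - l)! : ℂ) / ((k - l)! * (3 * n + 2 - k - 2 * l)! : ℂ)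
    * (-1) ^ k * (3 * n - 3 * k + 2 : ℂ) * (catalan (n - k) : ℂ)

/-- The normalized contour integral `(1 / 2πi) ∮ f(z) dz` over the positively oriented circle
around `0` of radius `ρ`. -/
def contour (ρ : ℝ) (f : ℂ → ℂ) : ℂ :=
  (2 * Real.pi * Complex.I)⁻¹ * ∮ z in C(0, ρ), f z

/-- The `r`-dependence of the integrands for parity `ε = 0`. -/
def phi0 (n k i : ℕ) (r : ℂ) : ℂ :=
  (1 + r) ^ (n - k) / ((1 - r) * r ^ ((i : ℤ) - 2 * k))

/-- The `r`-dependence of the integrands for parity `ε = 1`. -/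
def phi1 (n k i : ℕ) (r : ℂ) : ℂ :=
  (1 + r) ^ (n - k) / r ^ ((i : ℤ) - 2 * k + 1)

/-- The function `h_n^{0,𝐛}`. -/
def h0 (ρ : ℝ) (n i : ℕ) : ℂ :=
  -(((i + 1) % 2 : ℕ) : ℂ) +
    ∑ k ∈ Finset.range (n + 1), p n k 0 * contour ρ (fun r => phi0 n k i r)

/-- The function `h_n^{1,𝐛}`. -/
def h1 (ρ : ℝ) (n i : ℕ) : ℂ :=
  ∑ k ∈ Finset.range (n + 1), p n k 0 * contour ρ (fun r => phi1 n k i r)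

/-- The quadruple sum of fourfold contour integrals common to the four kernels; `f` and `g` are
the integrands in `r₁` and `r₂`. -/
def quad (ρ : ℝ) (n : ℕ) (f g : ℕ → ℕ → ℕ → ℂ → ℂ) (i j : ℕ) : ℂ :=
  ∑ k₁ ∈ Finset.range (n + 1), ∑ l₁ ∈ Finset.range (k₁ + 1),
  ∑ k₂ ∈ Finset.range (n + 1), ∑ l₂ ∈ Finset.range (k₂ + 1),
    p n k₁ l₁ * p n k₂ l₂ *
      contour ρ (fun r₁ => contour ρ (fun r₂ => contour ρ (fun s₁ => contour ρ (fun s₂ =>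
        f n k₁ i r₁ * g n k₂ j r₂ *
          ((s₁ - s₂) / ((s₁ * s₂ - 1) * s₁ ^ (l₁ + 1) * s₂ ^ (l₂ + 1)))))))

/-- The kernel `t_n^{0,0}`. -/
def t00 (ρ : ℝ) (n i j : ℕ) : ℂ :=
  (if i < j then (((i + 1) % 2 : ℕ) : ℂ) * ((j % 2 : ℕ) : ℂ) else 0)
    - (if j < i then ((i % 2 : ℕ) : ℂ) * (((j + 1) % 2 : ℕ) : ℂ) else 0)
    + (((j + 1) % 2 : ℕ) : ℂ) * h0 ρ n i - (((i + 1) % 2 : ℕ) : ℂ) * h0 ρ n j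
    + quad ρ n phi0 phi0 i j

/-- The kernel `t_n^{1,0}`. -/
def t10 (ρ : ℝ) (n i j : ℕ) : ℂ :=
  (((j + 1) % 2 : ℕ) : ℂ) * h1 ρ n i + quad ρ n phi1 phi0 i j

/-- The kernel `t_n^{0,1}`. -/
def t01 (ρ : ℝ) (n i j : ℕ) : ℂ :=
  -(((i + 1) % 2 : ℕ) : ℂ) * h1 ρ n j + quad ρ n phi0 phi1 i j

/-- The kernel `t_n^{1,1}`. -/
def t11 (ρ : ℝ) (n i j : ℕ) : ℂ :=
  quad ρ n phi1 phi1 i j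

/-- The generalized binomial coefficient `(m choose l)` with integer `m` (possibly `m = -1`),
`m (m - 1) ⋯ (m - l + 1) / l!`, as a complex number. -/
def binom (m : ℤ) (l : ℕ) : ℂ := ((Ring.choose m l : ℤ) : ℂ)

end TSSCPP

end

/-!
Call a vertex `x` even or odd according to the parity of `x₂ - x₁`, and write it as
`(i, i + 2m)` or `(i, i + 2m + 1)`. The inverse is written down for all pairs of vertices at once,

  `inverse n x y = form n (vec n x) (vec n y) + elemPart x y`,

and the proof checks that `K n * inverse n = 1`; the formulas of the theorem are then read off.

*The kernels.* The contour integrals are residues. Those in `r` are (partial sums of) binomial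
coefficients, `contour_phi0` and `contour_phi1`, and the double integral in `s₁, s₂` is the
alternating matrix with entries `1` next to the diagonal, `contour_contour`. Hence each of the four
kernels is the value of one alternating form `form n` on vectors `e0 n i`, `e1 n i`, plus an
elementary kernel for `t_n^{0,0}`. The component `0` of the vectors accounts for the terms with
`h_n^{ε,𝐛}`; see `t00_eq` and the lemmas after it.

*Off the diagonal.* The equations of `K n` at the odd vertices determine a function at the even
vertices from its values on the diagonal `(i, i)`, and those at the even vertices off the diagonal
determine it at the odd vertices from its values at `(i, i + 1)`. The solutions are `ext0` and
`ext1`, the binomial sums of the theorem. On the diagonal, the equations reduce to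
`e1_add_e1_add_e0`. So `inverse n` satisfies all equations of an unbounded domain, with the
right-hand side `1` at `x = y` contributed by `elemPart` (`elemCross_odd_equation` and the lemmas
after it).

*The boundary.* It remains to show that `inverse n` vanishes at the virtual vertices `(i, 2n + 2)`
just above the graph, and to look at the corner near `(2n, 2n)`. At the odd ones of these vertices
the vector `ext1 (e1 n) i m` itself vanishes. At the even one `(2k, 2n + 2)` it is, up to sign, the
vector `bdry n k`, and the needed identity is `form_bdry`: the form with `bdry n k` evaluates the
component `k + 1` of the other vector, up to a multiple of the component `0`. In coordinates this
says that the matrix of the weights `p(n, k, l)` is inverse to a matrix built from the sums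
`∑ₖ p(n, k, l) S(k, k')`, where `S = binomSum` is made of partial sums of binomial coefficients.
For `l ≤ k'` this sum is `(-1)ˡ 2ⁿ⁻ᵏ'` (`sum_p_mul_binomSum`), and since the symmetric part of `S`
has rank one (`binomSum_add_swap`), this determines one triangular half of the product of the two
matrices from the other (`bdryPairing_sub`).

*The summations.* As `p(n, k, l) = (-1)ˡ p(n - l, k - l, 0)`, only `l = 0` matters. Taking
differences of `S`, which is a sum up to a variable bound, leaves the two terminating
hypergeometric sums `sum_orthTerm_eq_zero` and `sum_powTerm`, both proved by creative telescoping.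
-/

noncomputable section

namespace TSSCPP

/-! ### Two strange hypergeometric summations -/

/-- The reciprocal factorial `1 / m!`, extended by `0` to negative integers, so that
`1 / (m - 1)! = m / m!` holds without exception. -/
def invFact (m : ℤ) : ℂ := if 0 ≤ m then ((m.toNat)! : ℂ)⁻¹ else 0

lemma invFact_natCast (m : ℕ) : invFact m = ((m)! : ℂ)⁻¹ := by simp [invFact]

lemma invFact_of_neg {m : ℤ} (h : m < 0) : invFact m = 0 := by
  simp [invFact, not_le.2 h]

lemma invFact_sub_one (m : ℤ) : invFact (m - 1) = m * invFact m := by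
  rcases lt_trichotomy m 0 with h | rfl | h
  · rw [invFact_of_neg h, invFact_of_neg (by omega), mul_zero]
  · simp [invFact_of_neg]
  · obtain ⟨k, rfl⟩ : ∃ k : ℕ, m = k + 1 := ⟨(m - 1).toNat, by omega⟩
    have h1 : ((k : ℤ) + 1) = ((k + 1 : ℕ) : ℤ) := by push_cast; ring
    rw [add_sub_cancel_right, h1, invFact_natCast, invFact_natCast, Nat.factorial_succ]
    have : (k : ℂ) + 1 ≠ 0 := by exact_mod_cast k.succ_ne_zero
    have : ((k)! : ℂ) ≠ 0 := by exact_mod_cast k.factorial_ne_zero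
    push_cast
    field_simp

lemma choose_eq_invFact (a m : ℕ) :
    (a.choose m : ℂ) = (a)! * invFact m * invFact (a - m) := by
  rcases lt_or_ge a m with h | h
  · rw [Nat.choose_eq_zero_of_lt h, invFact_of_neg (m := (a : ℤ) - m) (by omega)]; simp
  · rw [← Nat.cast_sub h, invFact_natCast, invFact_natCast, Nat.cast_choose ℂ h]
    field_simp

lemma succ_succ_mul_catalan_succ (i : ℕ) :
    ((i : ℂ) + 2) * catalan (i + 1) = 2 * (2 * i + 1) * catalan i := by
  have h1 := succ_mul_catalan_eq_centralBinom i
  have h2 := succ_mul_catalan_eq_centralBinom (i + 1)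
  have h3 := Nat.succ_mul_centralBinom_succ i
  rw [← h1, ← h2] at h3
  have h4 : (i + 1) * ((i + 2) * catalan (i + 1)) = (i + 1) * (2 * (2 * i + 1) * catalan i) := by
    rw [h3]; ring
  exact_mod_cast Nat.eq_of_mul_eq_mul_left (Nat.succ_pos i) h4

/-- The factorial part of `p(n, n - i, 0)`. As a function of `x = n + 1` it is
`½ ∏_{1 ≤ j ≤ i} (x² - j²) / (4x² - j²)`, and it vanishes at `i = n + 1`. -/
def factPart (n i : ℕ) : ℂ :=
  (2 * n + 1 - i)! * (n + i + 1)! * invFact (n - i) * ((2 * n + i + 2)! : ℂ)⁻¹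

lemma factPart_succ {n i : ℕ} (h : i ≤ n) :
    factPart n (i + 1) * (4 * ((n : ℂ) + 1) ^ 2 - (i + 1) ^ 2) =
      factPart n i * (((n : ℂ) + 1) ^ 2 - (i + 1) ^ 2) := by
  obtain ⟨r, rfl⟩ := Nat.exists_eq_add_of_le h
  have e1 : 2 * (i + r) + 1 - i = (i + 2 * r) + 1 := by omega
  have e2 : 2 * (i + r) + 1 - (i + 1) = i + 2 * r := by omega
  have e3 : (((i + r : ℕ) : ℤ) - ((i + 1 : ℕ) : ℤ)) = (r : ℤ) - 1 := by push_cast; ring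
  have e4 : (((i + r : ℕ) : ℤ) - (i : ℤ)) = (r : ℤ) := by push_cast; ring
  have e5 : (i + r) + (i + 1) + 1 = ((i + r) + i + 1) + 1 := by ring
  have e6 : 2 * (i + r) + (i + 1) + 2 = (2 * (i + r) + i + 2) + 1 := by ring
  rw [factPart, factPart, e1, e2, e3, e4, e5, e6, invFact_sub_one, Nat.factorial_succ (i + 2 * r),
    Nat.factorial_succ (i + r + i + 1), Nat.factorial_succ (2 * (i + r) + i + 2)]
  have h1 : (2 * ((i : ℂ) + r) + i + 2 + 1) * (2 * ((i : ℂ) + r) + i + 2 + 1)⁻¹ = 1 :=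
    mul_inv_cancel₀ (by exact_mod_cast Nat.succ_ne_zero (2 * (i + r) + i + 2))
  push_cast
  rw [mul_inv]
  linear_combination ((i + 2 * r)! : ℂ) * (i + r + i + 1 + 1) * (i + r + i + 1)! * r *
    invFact r * ((2 * (i + r) + i + 2)! : ℂ)⁻¹ * (i + 2 * r + 1) * h1

lemma factPart_self_succ (n : ℕ) : factPart n (n + 1) = 0 := by
  rw [factPart, invFact_of_neg (by push_cast; omega)]; ring

lemma factPart_zero (n : ℕ) : factPart n 0 = 1 / 2 := by
  have e : ((n : ℤ) - ((0 : ℕ) : ℤ)) = (n : ℤ) := by simp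
  rw [factPart, e, invFact_natCast]
  simp only [Nat.sub_zero, add_zero]
  rw [Nat.factorial_succ (2 * n + 1), Nat.factorial_succ n]
  have h1 : ((2 * n + 1)! : ℂ) ≠ 0 := by exact_mod_cast Nat.factorial_ne_zero _
  have h2 : ((n)! : ℂ) ≠ 0 := by exact_mod_cast Nat.factorial_ne_zero _
  have h3 : (n : ℂ) + 1 ≠ 0 := by exact_mod_cast n.succ_ne_zero
  have h4 : 2 * (n : ℂ) + 1 + 1 = 2 * (n + 1) := by ring
  push_cast
  rw [h4]
  field_simp

/-- The summand of the vanishing sum `sum_factPart_eq_zero`. -/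
def orthTerm (n d i : ℕ) : ℂ :=
  (-1) ^ i * (3 * i + 2) * catalan i * factPart n i *
    ((d + i)! * invFact (2 * i + 1 - d) * invFact (2 * d - i))

/-- The certificate of the creative-telescoping recurrence in `d` for `orthTerm`. -/
def orthCert (n d i : ℕ) : ℂ :=
  -3 * (d + 1) * (-1) ^ i * catalan i * factPart n i * (i + 1) *
    (4 * ((n : ℂ) + 1) ^ 2 - i ^ 2) *
    ((d + i)! * invFact (2 * i - 1 - d) * invFact (2 * d + 2 - i))

lemma orthTerm_recurrence {n i : ℕ} (d : ℕ) (h : i ≤ n) :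
    d * (4 * ((n : ℂ) + 1) ^ 2 - (d + 1) ^ 2) * orthTerm n d i +
      2 * (2 * d + 3) * (((n : ℂ) + 1) ^ 2 - (d + 1) ^ 2) * orthTerm n (d + 1) i =
    orthCert n d (i + 1) - orthCert n d i := by
  have hc := succ_succ_mul_catalan_succ i
  have hf := factPart_succ h
  have a1 : invFact (2 * (i : ℤ) - d) = (2 * i + 1 - d) * invFact (2 * i + 1 - d) := by
    have := invFact_sub_one (2 * (i : ℤ) + 1 - d)
    rw [show (2 * (i : ℤ) + 1 - d - 1) = 2 * i - d by ring] at this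
    rw [this]; push_cast; ring
  have a2 : invFact (2 * (i : ℤ) - 1 - d) = (2 * i - d) * invFact (2 * i - d) := by
    have := invFact_sub_one (2 * (i : ℤ) - d)
    rw [show (2 * (i : ℤ) - d - 1) = 2 * i - 1 - d by ring] at this
    rw [this]; push_cast; ring
  have b1 : invFact (2 * (d : ℤ) + 1 - i) = (2 * d + 2 - i) * invFact (2 * d + 2 - i) := by
    have := invFact_sub_one (2 * (d : ℤ) + 2 - i)
    rw [show (2 * (d : ℤ) + 2 - i - 1) = 2 * d + 1 - i by ring] at this
    rw [this]; push_cast; ring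
  have b2 : invFact (2 * (d : ℤ) - i) = (2 * d + 1 - i) * invFact (2 * d + 1 - i) := by
    have := invFact_sub_one (2 * (d : ℤ) + 1 - i)
    rw [show (2 * (d : ℤ) + 1 - i - 1) = 2 * d - i by ring] at this
    rw [this]; push_cast; ring
  have c1 : (2 * (i : ℤ) + 1 - ((d + 1 : ℕ) : ℤ)) = 2 * i - d := by push_cast; ring
  have c2 : (2 * ((d + 1 : ℕ) : ℤ) - i) = 2 * d + 2 - i := by push_cast; ring
  have c3 : (2 * ((i + 1 : ℕ) : ℤ) - 1 - d) = 2 * i + 1 - d := by push_cast; ring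
  have c4 : (2 * (d : ℤ) + 2 - ((i + 1 : ℕ) : ℤ)) = 2 * d + 1 - i := by push_cast; ring
  have e1 : d + 1 + i = (d + i) + 1 := by ring
  have e2 : d + (i + 1) = (d + i) + 1 := by ring
  simp only [orthTerm, orthCert]
  rw [c1, c2, c3, c4, e1, e2, a2, a1, b2, b1, Nat.factorial_succ (d + i)]
  have key : orthCert n d (i + 1) = 3 * (d + 1) * (-1) ^ i * (2 * (2 * i + 1) * catalan i) *
      (factPart n i * (((n : ℂ) + 1) ^ 2 - (i + 1) ^ 2)) *
      (((d : ℂ) + i + 1) * (d + i)! * invFact (2 * i + 1 - d) *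
        ((2 * d + 2 - i) * invFact (2 * d + 2 - i))) := by
    rw [← hc, ← hf, orthCert, c3, c4, e2, b1, Nat.factorial_succ (d + i)]
    push_cast; ring
  have key2 := key
  rw [orthCert, c3, c4, e2, b1, Nat.factorial_succ (d + i)] at key2
  rw [key2]
  push_cast
  ring

/-- The creative-telescoping recurrence has the coefficient `0` in front of the sum for `d = 0`,
and a nonzero coefficient in front of the sum for `d + 1 ≤ n`. -/
lemma sum_orthTerm_eq_zero {n d : ℕ} (hd : 1 ≤ d) (hdn : d ≤ n) :
    ∑ i ∈ Finset.range (n + 1), orthTerm n d i = 0 := by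
  have hrec : ∀ d : ℕ, d * (4 * ((n : ℂ) + 1) ^ 2 - (d + 1) ^ 2) *
        ∑ i ∈ Finset.range (n + 1), orthTerm n d i +
      2 * (2 * d + 3) * (((n : ℂ) + 1) ^ 2 - (d + 1) ^ 2) *
        ∑ i ∈ Finset.range (n + 1), orthTerm n (d + 1) i = 0 := by
    intro d
    rw [Finset.mul_sum, Finset.mul_sum, ← Finset.sum_add_distrib,
      Finset.sum_congr rfl fun i hi =>
        orthTerm_recurrence d (Nat.lt_succ_iff.1 (Finset.mem_range.1 hi)),
      Finset.sum_range_sub, orthCert, orthCert, factPart_self_succ,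
      invFact_of_neg (m := 2 * ((0 : ℕ) : ℤ) - 1 - d) (by push_cast; omega)]
    ring
  have step : ∀ d : ℕ, d + 1 ≤ n → (d * ∑ i ∈ Finset.range (n + 1), orthTerm n d i = 0) →
      ∑ i ∈ Finset.range (n + 1), orthTerm n (d + 1) i = 0 := by
    intro d hd h0
    have h := hrec d
    have h1 : 2 * (2 * (d : ℂ) + 3) * (((n : ℂ) + 1) ^ 2 - (d + 1) ^ 2) ≠ 0 := by
      obtain ⟨r, rfl⟩ := Nat.exists_eq_add_of_le hd
      have : 2 * (2 * (d : ℂ) + 3) * ((((d + 1 + r : ℕ) : ℂ) + 1) ^ 2 - (d + 1) ^ 2) =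
          ((2 * (2 * d + 3) * ((r + 1) * (2 * d + r + 3)) : ℕ) : ℂ) := by push_cast; ring
      rw [this]
      exact Nat.cast_ne_zero.2 (by positivity)
    have h2 : 2 * (2 * (d : ℂ) + 3) * (((n : ℂ) + 1) ^ 2 - (d + 1) ^ 2) *
        ∑ i ∈ Finset.range (n + 1), orthTerm n (d + 1) i = 0 := by
      linear_combination h - (4 * ((n : ℂ) + 1) ^ 2 - (d + 1) ^ 2) * h0
    exact (mul_eq_zero.1 h2).resolve_left h1
  induction d, hd using Nat.le_induction with
  | base => exact step 0 hdn (by simp)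
  | succ d hd ih => exact step d hdn (by rw [ih (by omega), mul_zero])

/-- The summand of `∑ᵢ (-2)ⁱ (3i + 2) Cᵢ factPart n i`. -/
def powTerm (n i : ℕ) : ℂ := (-2) ^ i * (3 * i + 2) * catalan i * factPart n i

/-- The telescoping certificate for `powTerm n i + powTerm (n + 1) i`. -/
def powCert (n i : ℕ) : ℂ :=
  -(2 * n + 3) * (i + 1) * (2 * n + i + 4) * (2 * n - i + 2) * ((-2) ^ i * catalan i *
    ((2 * n + 1 - i)! * (n + i + 1)! * invFact (n + 1 - i) * ((2 * n + i + 4)! : ℂ)⁻¹))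

lemma powTerm_add_powTerm_succ {n i : ℕ} (h : i ≤ n + 1) :
    powTerm n i + powTerm (n + 1) i = powCert n (i + 1) - powCert n i := by
  have hc := succ_succ_mul_catalan_succ i
  have hA1 : ((2 * (n + 1) + 1 - i)! : ℂ) =
      (2 * n + 3 - i) * (2 * n + 2 - i) * (2 * n + 1 - i)! := by
    rw [show 2 * (n + 1) + 1 - i = (2 * n + 1 - i) + 1 + 1 by omega, Nat.factorial_succ,
      Nat.factorial_succ]
    push_cast [Nat.cast_sub (show i ≤ 2 * n + 1 by omega)]
    ring
  -- The factor `n + 1 - i` takes care of the truncated subtraction for `n = 0`, `i = 1`.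
  have hA2 : (n + 1 - i : ℂ) * (2 * n + 1 - i) * ((2 * n + 1 - (i + 1))! : ℂ) =
      (n + 1 - i) * (2 * n + 1 - i)! := by
    rcases h.eq_or_lt with rfl | h
    · push_cast; ring
    · obtain ⟨r, rfl⟩ := Nat.exists_eq_add_of_le (Nat.lt_succ_iff.1 h)
      rw [show 2 * (i + r) + 1 - i = (i + 2 * r) + 1 by omega,
        show 2 * (i + r) + 1 - (i + 1) = i + 2 * r by omega, Nat.factorial_succ]
      push_cast
      ring
  have hJ : invFact ((n : ℤ) - i) = (n + 1 - i) * invFact ((n : ℤ) + 1 - i) := by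
    have := invFact_sub_one ((n : ℤ) + 1 - i)
    rw [show ((n : ℤ) + 1 - i - 1) = n - i by ring] at this
    rw [this]; push_cast; ring
  have hW : ((2 * n + i + 2)! : ℂ)⁻¹ =
      (2 * n + i + 3) * (2 * n + i + 4) * ((2 * n + i + 4)! : ℂ)⁻¹ := by
    rw [Nat.factorial_succ (2 * n + i + 3), Nat.factorial_succ (2 * n + i + 2)]
    have h1 : (2 * (n : ℂ) + i + 3) ≠ 0 := by exact_mod_cast Nat.succ_ne_zero (2 * n + i + 2)
    have h2 : (2 * (n : ℂ) + i + 4) ≠ 0 := by exact_mod_cast Nat.succ_ne_zero (2 * n + i + 3)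
    have h3 : ((2 * n + i + 2)! : ℂ) ≠ 0 := by exact_mod_cast Nat.factorial_ne_zero _
    push_cast
    rw [show (2 * (n : ℂ) + i + 3 + 1) = 2 * n + i + 4 by ring,
      show (2 * (n : ℂ) + i + 2 + 1) = 2 * n + i + 3 by ring]
    field_simp
  have hW' : (2 * (n : ℂ) + i + 5) * ((2 * n + i + 5)! : ℂ)⁻¹ = ((2 * n + i + 4)! : ℂ)⁻¹ := by
    rw [Nat.factorial_succ (2 * n + i + 4)]
    have h1 : (2 * (n : ℂ) + i + 5) ≠ 0 := by exact_mod_cast Nat.succ_ne_zero (2 * n + i + 4)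
    have h3 : ((2 * n + i + 4)! : ℂ) ≠ 0 := by exact_mod_cast Nat.factorial_ne_zero _
    push_cast
    rw [show (2 * (n : ℂ) + i + 4 + 1) = 2 * n + i + 5 by ring]
    field_simp
  have hG : powCert n (i + 1) = -(2 * n + 3) * ((i + 2) * catalan (i + 1)) * (-2) ^ (i + 1) *
      ((n + 1 - i : ℂ) * (2 * n + 1 - i) * ((2 * n + 1 - (i + 1))! : ℂ)) *
      ((n + i + 2) * (n + i + 1)!) * invFact ((n : ℤ) + 1 - i) *
      ((2 * (n : ℂ) + i + 5) * ((2 * n + i + 5)! : ℂ)⁻¹) := by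
    rw [powCert, show ((n : ℤ) + 1 - ((i + 1 : ℕ) : ℤ)) = n - i by push_cast; ring, hJ,
      show n + (i + 1) + 1 = (n + i + 1) + 1 by ring, Nat.factorial_succ (n + i + 1),
      show 2 * n + (i + 1) + 4 = 2 * n + i + 5 by ring]
    push_cast
    ring
  rw [hG, hc, hA2, hW', powTerm, powTerm, powCert, factPart, factPart, hA1, hJ, hW,
    show n + 1 + i + 1 = (n + i + 1) + 1 by ring, Nat.factorial_succ (n + i + 1),
    show 2 * (n + 1) + i + 2 = 2 * n + i + 4 by ring,
    show (((n + 1 : ℕ) : ℤ) - (i : ℤ)) = n + 1 - i by push_cast; ring]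
  push_cast
  ring

lemma sum_powTerm (n : ℕ) :
    ∑ i ∈ Finset.range (n + 1), powTerm n i = if Even n then 1 else 0 := by
  induction n with
  | zero => norm_num [powTerm, factPart_zero]
  | succ n ih =>
    have h0 : powCert n 0 = -1 := by
      rw [powCert, Nat.sub_zero, show ((n : ℤ) + 1 - ((0 : ℕ) : ℤ)) = ((n + 1 : ℕ) : ℤ) by
        push_cast; ring, invFact_natCast]
      simp only [add_zero]
      rw [Nat.factorial_succ (2 * n + 3), Nat.factorial_succ (2 * n + 2),
        Nat.factorial_succ (2 * n + 1)]
      have h1 : ((2 * n + 1)! : ℂ) ≠ 0 := by exact_mod_cast Nat.factorial_ne_zero _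
      have h2 : ((n + 1)! : ℂ) ≠ 0 := by exact_mod_cast Nat.factorial_ne_zero _
      have h3 : (2 * (n : ℂ) + 2) ≠ 0 := by exact_mod_cast Nat.succ_ne_zero (2 * n + 1)
      have h4 : (2 * (n : ℂ) + 3) ≠ 0 := by exact_mod_cast Nat.succ_ne_zero (2 * n + 2)
      have h5 : (2 * (n : ℂ) + 4) ≠ 0 := by exact_mod_cast Nat.succ_ne_zero (2 * n + 3)
      push_cast
      rw [show (2 * (n : ℂ) + 3 + 1) = 2 * n + 4 by ring,
        show (2 * (n : ℂ) + 2 + 1) = 2 * n + 3 by ring,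
        show (2 * (n : ℂ) + 1 + 1) = 2 * n + 2 by ring]
      simp only [add_zero, sub_zero, zero_add, pow_zero, catalan_zero,
        Nat.cast_one, one_mul, mul_one]
      field_simp
    have h1 : powCert n (n + 2) = 0 := by
      rw [powCert, invFact_of_neg (m := (n : ℤ) + 1 - ((n + 2 : ℕ) : ℤ)) (by push_cast; omega)]
      ring
    have h2 : powTerm n (n + 1) = 0 := by rw [powTerm, factPart_self_succ, mul_zero]
    have h3 : ∑ i ∈ Finset.range (n + 2), (powTerm n i + powTerm (n + 1) i) = 1 := by
      rw [Finset.sum_congr rfl fun i hi =>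
        powTerm_add_powTerm_succ (Nat.lt_succ_iff.1 (Finset.mem_range.1 hi)),
        Finset.sum_range_sub, h0, h1]
      ring
    rw [Finset.sum_add_distrib, Finset.sum_range_succ (powTerm n), h2, add_zero, ih] at h3
    rw [← eq_sub_iff_add_eq'] at h3
    rw [h3]
    by_cases h : Even n <;> simp [h, Nat.even_add_one]

/-! ### Summation formulas for the weights `p` -/

lemma p_sub_zero {n i : ℕ} (h : i ≤ n) :
    p n (n - i) 0 = (-1) ^ n * ((-1) ^ i * (3 * i + 2) * catalan i * factPart n i) := by
  obtain ⟨r, rfl⟩ := Nat.exists_eq_add_of_le h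
  have e1 : (((i + r : ℕ) : ℤ) - (i : ℤ)) = (r : ℤ) := by push_cast; ring
  have e2 : i + r - i = r := by omega
  have hs : (-1 : ℂ) ^ (i + r) * (-1) ^ i = (-1) ^ r := by
    rw [pow_add, mul_right_comm, ← mul_pow]; norm_num
  rw [p, factPart, e1, e2, invFact_natCast]
  have a1 : i + r + r + 1 - 2 * 0 = i + 2 * r + 1 := by omega
  have a2 : 2 * (i + r) + 1 - r - 0 = i + r + i + 1 := by omega
  have a3 : r - 0 = r := by omega
  have a4 : 3 * (i + r) + 2 - r - 2 * 0 = 2 * (i + r) + i + 2 := by omega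
  have a5 : 2 * (i + r) + 1 - i = i + 2 * r + 1 := by omega
  have a6 : i + r - r = i := by omega
  rw [a1, a2, a3, a4, a5, a6, ← hs]
  push_cast
  rw [div_eq_mul_inv, mul_inv]
  ring

lemma p_shift {n k l : ℕ} (hl : l ≤ k) (hk : k ≤ n) :
    p n k l = (-1) ^ l * p (n - l) (k - l) 0 := by
  obtain ⟨r, rfl⟩ := Nat.exists_eq_add_of_le hl
  obtain ⟨s, rfl⟩ := Nat.exists_eq_add_of_le hk
  rw [p, p, show l + r + s - l = r + s by omega, show l + r - l = r by omega,
    show l + r + s + (l + r) + 1 - 2 * l = r + s + r + 1 - 2 * 0 by omega,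
    show 2 * (l + r + s) + 1 - (l + r) - l = 2 * (r + s) + 1 - r - 0 by omega,
    show 3 * (l + r + s) + 2 - (l + r) - 2 * l = 3 * (r + s) + 2 - r - 2 * 0 by omega,
    show l + r + s - (l + r) = s by omega, show r + s - r = s by omega,
    show r - 0 = r by omega, pow_add]
  push_cast
  ring

lemma p_self {n l : ℕ} (h : l ≤ n) : p n n l = (-1) ^ n := by
  have h0 := p_sub_zero (Nat.zero_le (n - l))
  rw [p_shift h le_rfl]
  rw [Nat.sub_zero] at h0
  rw [h0, factPart_zero]
  have : (-1 : ℂ) ^ l * (-1) ^ (n - l) = (-1) ^ n := by rw [← pow_add, Nat.add_sub_cancel' h]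
  rw [← this]
  simp

/-- The partial sum of binomial coefficients `S(k', k)`; it is the component `k' + 1` of the vector
at the virtual vertex `(2k, 2n + 2)`, see `ext0_e0_boundary`. -/
def binomSum (n k' k : ℕ) : ℂ :=
  ∑ s ∈ Finset.range (n + k + 1 - 2 * k'), ((2 * n + 1 - k - k').choose s : ℂ)

/-- The partial sum `binomSum n (n - i) (n - d)`, which does not depend on `n`. -/
def codimSum (d i : ℕ) : ℂ := ∑ s ∈ Finset.range (2 * i + 1 - d), ((d + i + 1).choose s : ℂ)

lemma binomSum_sub_sub {n d i : ℕ} (hd : d ≤ n) (hi : i ≤ n) :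
    binomSum n (n - i) (n - d) = codimSum d i := by
  rw [binomSum, codimSum, show n + (n - d) + 1 - 2 * (n - i) = 2 * i + 1 - d by omega,
    show 2 * n + 1 - (n - d) - (n - i) = d + i + 1 by omega]

lemma sum_range_choose_succ (N M : ℕ) :
    ∑ s ∈ Finset.range (M + 1), ((N + 1).choose s : ℂ) =
      ∑ s ∈ Finset.range M, (N.choose s : ℂ) + ∑ s ∈ Finset.range (M + 1), (N.choose s : ℂ) := by
  induction M with
  | zero => simp
  | succ M ih =>
    rw [Finset.sum_range_succ, ih, Nat.choose_succ_succ', Finset.sum_range_succ _ M,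
      Finset.sum_range_succ _ (M + 1), Finset.sum_range_succ _ M]
    push_cast
    ring

lemma codimSum_succ (d i : ℕ) :
    codimSum (d + 1) i = 2 * codimSum d i - (3 * d + 4) *
      ((d + 1 + i)! * invFact (2 * i + 1 - (d + 1 : ℕ)) * invFact (2 * (d + 1 : ℕ) - i)) := by
  rcases lt_or_ge (2 * i) d with h | h
  · rw [codimSum, codimSum, show 2 * i + 1 - (d + 1) = 0 by omega,
      show 2 * i + 1 - d = 0 by omega,
      invFact_of_neg (m := 2 * (i : ℤ) + 1 - (d + 1 : ℕ)) (by push_cast; omega)]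
    simp
  · obtain ⟨m, hm⟩ := Nat.exists_eq_add_of_le h
    have e1 : (2 * (i : ℤ) + 1 - (d + 1 : ℕ)) = (m : ℤ) := by push_cast; omega
    have h1 := choose_eq_invFact (d + i + 1) m
    have h2 := choose_eq_invFact (d + i + 1 + 1) m
    rw [show ((d + i + 1 : ℕ) : ℤ) - m = (2 * (d + 1 : ℕ) - i) - 1 by push_cast; omega,
      invFact_sub_one] at h1
    rw [show ((d + i + 1 + 1 : ℕ) : ℤ) - m = 2 * (d + 1 : ℕ) - i by push_cast; omega,
      Nat.factorial_succ] at h2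
    have h3 : codimSum (d + 1) i = 2 * codimSum d i - (d + i + 1).choose m -
        (d + i + 1 + 1).choose m := by
      rw [codimSum, codimSum, show 2 * i + 1 - (d + 1) = m by omega,
        show 2 * i + 1 - d = m + 1 by omega, show d + 1 + i + 1 = d + i + 1 + 1 by ring]
      have := sum_range_choose_succ (d + i + 1) m
      rw [Finset.sum_range_succ] at this
      have h4 := Finset.sum_range_succ (fun s => ((d + i + 1).choose s : ℂ)) m
      linear_combination this - h4
    rw [h3, h1, h2, e1, show d + 1 + i = d + i + 1 by ring]
    push_cast
    ring

lemma sum_p_mul_codimSum {n d : ℕ} (h : d ≤ n) :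
    ∑ i ∈ Finset.range (n + 1), p n (n - i) 0 * codimSum d i = 2 ^ d := by
  have hV : ∑ i ∈ Finset.range (n + 1), p n (n - i) 0 * 2 ^ i = if Even n then 1 else 0 := by
    have : ∑ i ∈ Finset.range (n + 1), p n (n - i) 0 * 2 ^ i =
        (-1) ^ n * ∑ i ∈ Finset.range (n + 1), powTerm n i := by
      rw [Finset.mul_sum]
      refine Finset.sum_congr rfl fun i hi => ?_
      rw [p_sub_zero (Nat.lt_succ_iff.1 (Finset.mem_range.1 hi)), powTerm,
        show (-2 : ℂ) = (-1) * 2 by norm_num, mul_pow]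
      ring
    rw [this, sum_powTerm]
    by_cases h : Even n <;> simp [h]
  induction d with
  | zero =>
    have h0 : ∀ i, codimSum 0 i = 2 * 2 ^ i - if i = 0 then 1 else 0 := by
      intro i
      rcases Nat.eq_zero_or_pos i with rfl | hi
      · norm_num [codimSum]
      · have h1 : codimSum 0 i = ∑ s ∈ Finset.range (i + 1 + 1), ((i + 1).choose s : ℂ) := by
          rw [codimSum, Nat.zero_add]
          refine (Finset.sum_subset (Finset.range_subset_range.2 (by omega)) ?_).symm
          intro s _ hs
          rw [Finset.mem_range, not_lt] at hs
          rw [Nat.choose_eq_zero_of_lt (by omega), Nat.cast_zero]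
        rw [h1, ← Nat.cast_sum, Nat.sum_range_choose, if_neg hi.ne']
        push_cast
        ring
    have h1 : ∀ i, p n (n - i) 0 * codimSum 0 i =
        2 * (p n (n - i) 0 * 2 ^ i) - if i = 0 then p n n 0 else 0 := by
      intro i
      rw [h0]
      split_ifs with hi
      · subst hi; rw [Nat.sub_zero]; ring
      · ring
    rw [Finset.sum_congr rfl fun i _ => h1 i, Finset.sum_sub_distrib, ← Finset.mul_sum, hV,
      Finset.sum_ite_eq' (Finset.range (n + 1)) 0, if_pos (Finset.mem_range.2 n.succ_pos),
      p_self (Nat.zero_le n)]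
    rcases Nat.even_or_odd n with hn | hn
    · rw [if_pos hn, hn.neg_one_pow]; norm_num
    · rw [if_neg (Nat.not_even_iff_odd.2 hn), hn.neg_one_pow]; norm_num
  | succ d ih =>
    have h1 : ∀ i ∈ Finset.range (n + 1), p n (n - i) 0 * codimSum (d + 1) i =
        2 * (p n (n - i) 0 * codimSum d i) -
          (3 * d + 4) * (-1) ^ n * orthTerm n (d + 1) i := by
      intro i hi
      rw [codimSum_succ, p_sub_zero (Nat.lt_succ_iff.1 (Finset.mem_range.1 hi)), orthTerm]
      ring
    rw [Finset.sum_congr rfl h1, Finset.sum_sub_distrib, ← Finset.mul_sum, ← Finset.mul_sum,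
      ih (by omega), sum_orthTerm_eq_zero (by omega) h]
    ring

lemma sum_Ico_eq_sum_range_sub {n l : ℕ} (h : l ≤ n) (F : ℕ → ℂ) :
    ∑ k ∈ Finset.Ico l (n + 1), F k = ∑ i ∈ Finset.range (n - l + 1), F (n - i) := by
  rw [Finset.sum_Ico_eq_sum_range, show n + 1 - l = n - l + 1 by omega,
    ← Finset.sum_range_reflect]
  refine Finset.sum_congr rfl fun i hi => ?_
  rw [Finset.mem_range] at hi
  congr 1
  omega

/-- The numbers `v(l) = ∑ₖ 2ⁿ⁻ᵏ p(n, k, l)`. -/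
lemma sum_two_pow_mul_p (n l : ℕ) :
    ∑ k ∈ Finset.Ico l (n + 1), 2 ^ (n - k) * p n k l =
      if l ≤ n ∧ Even (n - l) then (-1) ^ l else 0 := by
  by_cases h : l ≤ n
  · have h0 := sum_p_mul_codimSum (Nat.zero_le (n - l))
    rw [sum_Ico_eq_sum_range_sub h]
    have h1 : ∀ i ∈ Finset.range (n - l + 1), 2 ^ (n - (n - i)) * p n (n - i) l =
        (-1) ^ l * (-1) ^ (n - l) * powTerm (n - l) i := by
      intro i hi
      have hi' := Nat.lt_succ_iff.1 (Finset.mem_range.1 hi)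
      rw [p_shift (by omega) (by omega), show n - i - l = n - l - i by omega, p_sub_zero hi',
        show n - (n - i) = i by omega, powTerm, show (-2 : ℂ) = (-1) * 2 by norm_num, mul_pow]
      ring
    rw [Finset.sum_congr rfl h1, ← Finset.mul_sum, sum_powTerm]
    by_cases h2 : Even (n - l) <;> simp [h2, h]
  · rw [Finset.Ico_eq_empty (by omega), if_neg (by tauto), Finset.sum_empty]

lemma sum_p_mul_binomSum {n k l : ℕ} (hl : l ≤ k) (hk : k ≤ n) :
    ∑ k' ∈ Finset.Ico l (n + 1), p n k' l * binomSum n k' k = (-1) ^ l * 2 ^ (n - k) := by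
  rw [sum_Ico_eq_sum_range_sub (hl.trans hk), ← sum_p_mul_codimSum (show n - k ≤ n - l by omega),
    Finset.mul_sum]
  refine Finset.sum_congr rfl fun i hi => ?_
  have hi' := Nat.lt_succ_iff.1 (Finset.mem_range.1 hi)
  have h1 := binomSum_sub_sub (n := n) (d := n - k) (i := i) (by omega) (by omega)
  rw [show n - (n - k) = k by omega] at h1
  rw [h1, p_shift (by omega) (by omega), show n - i - l = n - l - i by omega]
  ring

lemma binomSum_add_swap {n k k' : ℕ} (hk : k ≤ n) (hk' : k' ≤ n) :
    binomSum n k' k + binomSum n k k' = 2 ^ (2 * n + 1 - k - k') := by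
  -- After extension by zero, the two ranges are complementary under `s ↦ N - s`.
  have key : ∀ N a b : ℕ, a + b = N + 1 → ∑ s ∈ Finset.range a, (N.choose s : ℂ) +
      ∑ s ∈ Finset.range b, (N.choose s : ℂ) = 2 ^ N := by
    intro N a b hab
    have h1 : ∑ s ∈ Finset.range b, (N.choose s : ℂ) =
        ∑ s ∈ Finset.range b, (N.choose (a + s) : ℂ) := by
      rw [← Finset.sum_range_reflect]
      refine Finset.sum_congr rfl fun s hs => ?_
      rw [Finset.mem_range] at hs
      rw [← Nat.choose_symm (show a + s ≤ N by omega), show N - (a + s) = b - 1 - s by omega]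
    rw [h1, ← Finset.sum_range_add, hab, ← Nat.cast_sum, Nat.sum_range_choose]
    push_cast
    rfl
  have full : ∀ N a : ℕ, N + 1 ≤ a → ∑ s ∈ Finset.range a, (N.choose s : ℂ) = 2 ^ N := by
    intro N a ha
    rw [← Finset.sum_subset (Finset.range_subset_range.2 ha), ← Nat.cast_sum,
      Nat.sum_range_choose]
    · push_cast; rfl
    · intro s _ hs
      rw [Finset.mem_range, not_lt] at hs
      rw [Nat.choose_eq_zero_of_lt (by omega), Nat.cast_zero]
  rw [binomSum, binomSum, show 2 * n + 1 - k' - k = 2 * n + 1 - k - k' by omega]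
  rcases le_total (2 * k') (n + k + 1) with h1 | h1
  · rcases le_total (2 * k) (n + k' + 1) with h2 | h2
    · exact key _ _ _ (by omega)
    · rw [show n + k' + 1 - 2 * k = 0 by omega, Finset.sum_range_zero, add_zero]
      exact full _ _ (by omega)
  · rw [show n + k + 1 - 2 * k' = 0 by omega, Finset.sum_range_zero, zero_add]
    exact full _ _ (by omega)

/-! ### The alternating form -/

/-- The weight `p(n, k, l)`, extended by `0` to `k < l`, where the formula for `p` truncates. -/
def weight (n k l : ℕ) : ℂ := if l ≤ k then p n k l else 0

lemma sum_weight_mul (n l : ℕ) (F : ℕ → ℂ) :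
    ∑ k ∈ Finset.range (n + 1), weight n k l * F k =
      ∑ k ∈ Finset.Ico l (n + 1), p n k l * F k := by
  have : Finset.Ico l (n + 1) = (Finset.range (n + 1)).filter (fun k => l ≤ k) := by
    ext k; simp [and_comm]
  rw [this, Finset.sum_filter]
  exact Finset.sum_congr rfl fun k _ => by rw [weight]; split_ifs <;> simp

/-- The linear functionals diagonalizing the alternating form: a vector `X : ℕ → ℂ` is sent to
`X 0` for the index `0`, and to `∑ₖ p(n, k, l) X (k + 1)` for the index `l + 1`. -/
def coord (n : ℕ) : ℕ → (ℕ → ℂ) →ₗ[ℂ] ℂ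
  | 0 => LinearMap.proj 0
  | l + 1 => ∑ k ∈ Finset.range (n + 1), weight n k l • LinearMap.proj (k + 1)

lemma coord_zero (n : ℕ) (X : ℕ → ℂ) : coord n 0 X = X 0 := rfl

lemma coord_succ (n l : ℕ) (X : ℕ → ℂ) :
    coord n (l + 1) X = ∑ k ∈ Finset.range (n + 1), weight n k l * X (k + 1) := by
  simp [coord, LinearMap.sum_apply]

lemma coord_of_lt {n l : ℕ} (h : n < l) (X : ℕ → ℂ) : coord n (l + 1) X = 0 := by
  rw [coord_succ, sum_weight_mul n l (fun k => X (k + 1)), Finset.Ico_eq_empty (by omega),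
    Finset.sum_empty]

/-- The alternating form `ω(X, Y) = ∑_L (X_L Y_{L+1} - X_{L+1} Y_L)` in the coordinates `coord`.
The nonelementary part of the inverse Kasteleyn matrix is `ω` of two vectors attached to the
vertices. -/
def form (n : ℕ) : (ℕ → ℂ) →ₗ[ℂ] (ℕ → ℂ) →ₗ[ℂ] ℂ :=
  ∑ L ∈ Finset.range (n + 1),
    ((coord n L).smulRight (coord n (L + 1)) - (coord n (L + 1)).smulRight (coord n L))

lemma form_apply (n : ℕ) (X Y : ℕ → ℂ) :
    form n X Y = ∑ L ∈ Finset.range (n + 1),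
      (coord n L X * coord n (L + 1) Y - coord n (L + 1) X * coord n L Y) := by
  simp [form, LinearMap.sum_apply]

/-- The vector at the virtual vertex `(2k, 2n + 2)` just above the graph, up to sign; see
`ext0_e0_boundary`. -/
def bdry (n k : ℕ) : ℕ → ℂ
  | 0 => -2 ^ (n - k)
  | k' + 1 => binomSum n k' k

lemma coord_bdry_of_le {n k L : ℕ} (hk : k ≤ n) (hL : L ≤ k + 1) :
    coord n L (bdry n k) = (-1) ^ (L + 1) * 2 ^ (n - k) := by
  cases L with
  | zero => rw [coord_zero, bdry]; ring
  | succ l =>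
    rw [coord_succ, sum_weight_mul n l (fun k' => bdry n k (k' + 1))]
    simp only [bdry]
    rw [sum_p_mul_binomSum (by omega) hk]
    ring

/-- The numbers `v(l) = ∑ₖ 2ⁿ⁻ᵏ p(n, k, l)` of `sum_two_pow_mul_p`. -/
def powSum (n l : ℕ) : ℂ := if l ≤ n ∧ Even (n - l) then (-1) ^ l else 0

lemma sum_weight_mul_two_pow (n l : ℕ) :
    ∑ k ∈ Finset.range (n + 1), weight n k l * 2 ^ (n - k) = powSum n l := by
  rw [sum_weight_mul n l (fun k => 2 ^ (n - k)), powSum, ← sum_two_pow_mul_p]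
  exact Finset.sum_congr rfl fun k _ => mul_comm _ _

/-- The pairings of the boundary functionals with the columns of the weights. -/
def bdryPairing (n L l : ℕ) : ℂ :=
  ∑ k ∈ Finset.range (n + 1), weight n k l * coord n L (bdry n k)

lemma bdryPairing_of_le {n L l : ℕ} (hL : L ≤ l + 1) :
    bdryPairing n L l = (-1) ^ (L + 1) * powSum n l := by
  rw [bdryPairing, ← sum_weight_mul_two_pow, Finset.mul_sum]
  refine Finset.sum_congr rfl fun k hk => ?_
  by_cases h : l ≤ k
  · rw [coord_bdry_of_le (by simpa [Nat.lt_succ_iff] using hk) (by omega)]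
    ring
  · simp [weight, h]

/-- The symmetric part of `binomSum` is a matrix of rank one. -/
lemma bdryPairing_add_swap (n l l' : ℕ) :
    bdryPairing n (l + 1) l' + bdryPairing n (l' + 1) l = 2 * powSum n l * powSum n l' := by
  have h1 : ∀ l l', bdryPairing n (l + 1) l' = ∑ k ∈ Finset.range (n + 1),
      ∑ k' ∈ Finset.range (n + 1), weight n k l' * weight n k' l * binomSum n k' k := by
    intro l l'
    rw [bdryPairing]
    refine Finset.sum_congr rfl fun k _ => ?_
    rw [coord_succ, Finset.mul_sum]
    exact Finset.sum_congr rfl fun k' _ => by simp only [bdry]; ring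
  rw [h1 l l', h1 l' l, Finset.sum_comm, ← Finset.sum_add_distrib,
    ← sum_weight_mul_two_pow, ← sum_weight_mul_two_pow, mul_assoc, Finset.sum_mul_sum,
    Finset.mul_sum]
  refine Finset.sum_congr rfl fun k' hk' => ?_
  rw [← Finset.sum_add_distrib, Finset.mul_sum]
  refine Finset.sum_congr rfl fun k hk => ?_
  rw [Finset.mem_range, Nat.lt_succ_iff] at hk hk'
  have h2 := binomSum_add_swap hk hk'
  have h3 : (2 : ℂ) ^ (2 * n + 1 - k - k') = 2 * (2 ^ (n - k') * 2 ^ (n - k)) := by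
    rw [← pow_add, ← pow_succ']; congr 1; omega
  rw [h3] at h2
  linear_combination weight n k l' * weight n k' l * h2

/-- The differences of consecutive boundary coordinates invert the matrix of weights. -/
lemma bdryPairing_sub {n l l' : ℕ} (hl : l ≤ n) :
    bdryPairing n (l + 2) l' - bdryPairing n l l' = if l = l' then 1 else 0 := by
  have hper : powSum n (l + 1) = if Even (n - l) then 0 else (-1) ^ (l + 1) := by
    rw [powSum]
    by_cases h : Even (n - l)
    · rw [if_pos h, if_neg]
      rintro ⟨h1, h2⟩
      rw [show n - l = n - (l + 1) + 1 by omega, Nat.even_add_one] at h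
      exact h h2
    · have h1 : l + 1 ≤ n := by
        by_contra h1
        exact h (by rw [show n - l = 0 by omega]; exact Even.zero)
      rw [if_neg h, if_pos]
      rw [show n - l = n - (l + 1) + 1 by omega, Nat.even_add_one, not_not] at h
      exact ⟨h1, h⟩
  rcases lt_or_ge l l' with h | h
  · rw [bdryPairing_of_le (by omega), bdryPairing_of_le (by omega), if_neg h.ne]
    ring
  have h1 := bdryPairing_add_swap n (l + 1) l'
  rw [bdryPairing_of_le (L := l' + 1) (l := l + 1) (by omega)] at h1
  have h1' : bdryPairing n (l + 2) l' =
      2 * powSum n (l + 1) * powSum n l' - (-1) ^ l' * powSum n (l + 1) := by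
    linear_combination h1
  have sq : ((-1 : ℂ) ^ l') * (-1) ^ l' = 1 := by rw [← mul_pow]; norm_num
  rcases h.eq_or_lt with rfl | h
  · rw [h1', bdryPairing_of_le (by omega), if_pos rfl, hper, powSum]
    by_cases h2 : Even (n - l')
    · rw [if_pos h2, if_pos ⟨hl, h2⟩]
      linear_combination sq
    · rw [if_neg h2, if_neg (by tauto)]
      linear_combination sq
  · rw [if_neg h.ne']
    obtain ⟨m, rfl⟩ : ∃ m, l = m + 1 := ⟨l - 1, by omega⟩
    have hm : powSum n (m + 1 + 1) = powSum n m := by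
      have hp : Even (n - m) ↔ ¬Even (n - (m + 1)) := by
        rw [show n - m = n - (m + 1) + 1 by omega, Nat.even_add_one]
      rw [hper, powSum]
      by_cases h2 : Even (n - (m + 1))
      · rw [if_pos h2, if_neg (by tauto)]
      · rw [if_neg h2, if_pos ⟨by omega, hp.2 h2⟩]; ring
    rw [h1', hm]
    rcases (show l' ≤ m by omega).eq_or_lt with rfl | h3
    · rw [bdryPairing_of_le (by omega), powSum]
      split_ifs
      · ring
      · ring
    · have h4 := bdryPairing_add_swap n m l'
      rw [bdryPairing_of_le (L := l' + 1) (l := m) (by omega)] at h4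
      linear_combination -h4

lemma sum_weight_mul_coord_bdry {n k k' : ℕ} (hk : k ≤ n) (hk' : k' ≤ n) :
    ∑ l ∈ Finset.range (n + 1), weight n k' l *
      (coord n (l + 2) (bdry n k) - coord n l (bdry n k)) = if k' = k then 1 else 0 := by
  let P : Matrix (Fin (n + 1)) (Fin (n + 1)) ℂ := Matrix.of fun k l => weight n k l
  let D : Matrix (Fin (n + 1)) (Fin (n + 1)) ℂ :=
    Matrix.of fun l k => coord n (l + 2) (bdry n k) - coord n l (bdry n k)
  have h : D * P = 1 := by
    ext l l'
    rw [Matrix.mul_apply, Matrix.one_apply]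
    have := bdryPairing_sub (l' := l') (Nat.lt_succ_iff.1 l.2)
    rw [bdryPairing, bdryPairing, ← Finset.sum_sub_distrib, Finset.sum_range] at this
    simp only [Fin.ext_iff]
    rw [← this]
    exact Finset.sum_congr rfl fun k _ => by simp only [D, P, Matrix.of_apply]; ring
  have h1 : P * D = 1 := mul_eq_one_comm.1 h
  have h2 := congrFun (congrFun h1 ⟨k', Nat.lt_succ_of_le hk'⟩)
    ⟨k, Nat.lt_succ_of_le hk⟩
  rw [Matrix.mul_apply, Matrix.one_apply] at h2
  simp only [Fin.ext_iff] at h2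
  rw [← h2, Finset.sum_range]
  rfl

/-- Pairing with a boundary vector evaluates at that boundary vertex. -/
theorem form_bdry {n k : ℕ} (hk : k ≤ n) (Y : ℕ → ℂ) :
    form n (bdry n k) Y = -Y (k + 1) - 2 ^ (n - k) * Y 0 := by
  have h1 : ∑ L ∈ Finset.range (n + 1), coord n (L + 1) (bdry n k) * coord n L Y =
      coord n 1 (bdry n k) * Y 0 +
        ∑ l ∈ Finset.range (n + 1), coord n (l + 2) (bdry n k) * coord n (l + 1) Y := by
    rw [Finset.sum_range_succ', Finset.sum_range_succ _ n,
      coord_of_lt (Nat.lt_succ_self n), coord_zero]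
    ring
  have h2 : ∑ l ∈ Finset.range (n + 1),
      (coord n (l + 2) (bdry n k) - coord n l (bdry n k)) * coord n (l + 1) Y = Y (k + 1) := by
    have h3 : ∀ l ∈ Finset.range (n + 1),
        (coord n (l + 2) (bdry n k) - coord n l (bdry n k)) * coord n (l + 1) Y =
        ∑ k' ∈ Finset.range (n + 1), Y (k' + 1) * (weight n k' l *
          (coord n (l + 2) (bdry n k) - coord n l (bdry n k))) := by
      intro l _
      rw [coord_succ n l Y, Finset.mul_sum]
      exact Finset.sum_congr rfl fun k' _ => by ring
    rw [Finset.sum_congr rfl h3, Finset.sum_comm]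
    have h4 : ∀ k' ∈ Finset.range (n + 1), (∑ l ∈ Finset.range (n + 1),
        Y (k' + 1) * (weight n k' l * (coord n (l + 2) (bdry n k) - coord n l (bdry n k)))) =
        if k' = k then Y (k + 1) else 0 := by
      intro k' hk'
      rw [← Finset.mul_sum, sum_weight_mul_coord_bdry hk (by simpa [Nat.lt_succ_iff] using hk')]
      split_ifs with h
      · rw [h, mul_one]
      · rw [mul_zero]
    rw [Finset.sum_congr rfl h4, Finset.sum_ite_eq' _ k, if_pos (Finset.mem_range.2 (by omega))]
  rw [form_apply, Finset.sum_sub_distrib, h1, coord_bdry_of_le hk (by omega)]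
  simp only [sub_mul, Finset.sum_sub_distrib] at h2
  linear_combination -h2

/-! ### The contour integrals -/

lemma contour_congr {ρ : ℝ} (hρ : 0 < ρ) {f g : ℂ → ℂ}
    (h : ∀ z : ℂ, ‖z‖ = ρ → f z = g z) : contour ρ f = contour ρ g := by
  rw [contour, contour, circleIntegral.integral_congr hρ.le]
  intro z hz
  exact h z (by simpa using hz)

lemma contour_const_mul (ρ : ℝ) (c : ℂ) (f : ℂ → ℂ) :
    contour ρ (fun z => c * f z) = c * contour ρ f := by
  rw [contour, contour, circleIntegral.integral_const_mul]
  ring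

lemma contour_sub {ρ : ℝ} (hρ : 0 < ρ) {f g : ℂ → ℂ}
    (hf : ContinuousOn f (Metric.sphere 0 ρ)) (hg : ContinuousOn g (Metric.sphere 0 ρ)) :
    contour ρ (fun z => f z - g z) = contour ρ f - contour ρ g := by
  rw [contour, contour, contour, circleIntegral.integral_sub (hf.circleIntegrable hρ.le)
    (hg.circleIntegrable hρ.le)]
  ring

lemma contour_zpow {ρ : ℝ} (hρ : 0 < ρ) (m : ℤ) :
    contour ρ (fun z => z ^ m) = if m = -1 then 1 else 0 := by
  have hpi : (2 * Real.pi * Complex.I : ℂ) ≠ 0 := Complex.two_pi_I_ne_zero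
  split_ifs with h
  · have := circleIntegral.integral_sub_center_inv 0 hρ.ne'
    simp only [sub_zero] at this
    simp only [h, zpow_neg_one]
    rw [contour, this, inv_mul_cancel₀ hpi]
  · have := circleIntegral.integral_sub_zpow_of_ne h 0 0 ρ
    simp only [sub_zero] at this
    rw [contour, this, mul_zero]

lemma contour_eq_zero {ρ : ℝ} (hρ : 0 < ρ) {f : ℂ → ℂ}
    (hf : DifferentiableOn ℂ f (Metric.closedBall 0 ρ)) : contour ρ f = 0 := by
  rw [contour, (hf.diffContOnCl_ball subset_rfl).circleIntegral_eq_zero hρ.le, mul_zero]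

lemma ne_zero_of_norm_eq {ρ : ℝ} (hρ : 0 < ρ) {z : ℂ} (h : ‖z‖ = ρ) : z ≠ 0 := by
  rintro rfl
  simp at h
  exact hρ.ne h

lemma mul_sub_one_ne_zero {c z : ℂ} (hc : ‖c‖ ≤ 1) (hz : ‖z‖ < 1) : c * z - 1 ≠ 0 := by
  intro h
  have : ‖c * z‖ = 1 := by rw [sub_eq_zero.1 h, norm_one]
  rw [norm_mul] at this
  nlinarith [norm_nonneg c, norm_nonneg z]

lemma contour_one_add_pow {ρ : ℝ} (hρ : 0 < ρ) (a : ℕ) (m : ℤ) :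
    contour ρ (fun r => (1 + r) ^ a / r ^ (m + 1)) =
      if 0 ≤ m then (a.choose m.toNat : ℂ) else 0 := by
  have h1 : contour ρ (fun r => (1 + r) ^ a / r ^ (m + 1)) =
      contour ρ (fun r =>
        ∑ s ∈ Finset.range (a + 1), (a.choose s : ℂ) * r ^ ((s : ℤ) - m - 1)) := by
    refine contour_congr hρ fun z hz => ?_
    have hz0 := ne_zero_of_norm_eq hρ hz
    rw [add_comm 1 z, add_pow, Finset.sum_div]
    refine Finset.sum_congr rfl fun s _ => ?_
    rw [show (s : ℤ) - m - 1 = s - (m + 1) by ring, zpow_sub₀ hz0, zpow_natCast, one_pow]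
    ring
  have h2 : ∀ s ∈ Finset.range (a + 1),
      (2 * Real.pi * Complex.I)⁻¹ * (∮ z in C(0, ρ), (a.choose s : ℂ) * z ^ ((s : ℤ) - m - 1)) =
        if (s : ℤ) = m then (a.choose s : ℂ) else 0 := by
    intro s _
    have := contour_const_mul ρ (a.choose s : ℂ) (fun z => z ^ ((s : ℤ) - m - 1))
    rw [contour_zpow hρ, contour] at this
    rw [this]
    by_cases h : (s : ℤ) = m
    · rw [if_pos (by omega), if_pos h, mul_one]
    · rw [if_neg (by omega), if_neg h, mul_zero]
  rw [h1, contour, circleIntegral.integral_fun_sum, Finset.mul_sum, Finset.sum_congr rfl h2]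
  · split_ifs with hm
    · obtain ⟨q, rfl⟩ := Int.eq_ofNat_of_zero_le hm
      simp only [Nat.cast_inj, Int.toNat_natCast]
      rw [Finset.sum_ite_eq' _ q]
      split_ifs with hq
      · rfl
      · rw [Nat.choose_eq_zero_of_lt (by simpa using hq), Nat.cast_zero]
    · exact Finset.sum_eq_zero fun s _ => if_neg (by omega)
  · intro s _
    refine ContinuousOn.circleIntegrable hρ.le ?_
    refine continuousOn_const.mul (ContinuousOn.zpow₀ continuousOn_id _ fun z hz => Or.inl ?_)
    exact ne_zero_of_norm_eq hρ (by simpa using hz)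

/-- Multiplication by `1 - r` relates consecutive pole orders. -/
lemma contour_one_add_pow_div {ρ : ℝ} (hρ₀ : 0 < ρ) (hρ₁ : ρ < 1) (a m : ℕ) :
    contour ρ (fun r => (1 + r) ^ a / ((1 - r) * r ^ m)) =
      ∑ s ∈ Finset.range m, (a.choose s : ℂ) := by
  have hne : ∀ z : ℂ, ‖z‖ ≤ ρ → 1 - z ≠ 0 := by
    intro z hz h
    rw [← sub_eq_zero.1 h, norm_one] at hz
    linarith
  have hcont : ∀ m : ℕ,
      ContinuousOn (fun r : ℂ => (1 + r) ^ a / ((1 - r) * r ^ m)) (Metric.sphere 0 ρ) := by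
    intro m
    refine ContinuousOn.div (by fun_prop) (by fun_prop) fun z hz => ?_
    have hz' : ‖z‖ = ρ := by simpa using hz
    exact mul_ne_zero (hne z hz'.le) (pow_ne_zero _ (ne_zero_of_norm_eq hρ₀ hz'))
  induction m with
  | zero =>
    rw [Finset.sum_range_zero]
    refine contour_eq_zero hρ₀ (DifferentiableOn.div (by fun_prop) (by fun_prop) fun z hz => ?_)
    simpa using hne z (by simpa using hz)
  | succ m ih =>
    rw [Finset.sum_range_succ, ← ih, ← sub_eq_iff_eq_add', ← contour_sub hρ₀ (hcont _) (hcont _)]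
    have h := contour_one_add_pow hρ₀ a (m : ℤ)
    rw [if_pos (by positivity), Int.toNat_natCast] at h
    rw [← h]
    refine contour_congr hρ₀ fun z hz => ?_
    have h1 := hne z hz.le
    have h2 := ne_zero_of_norm_eq hρ₀ hz
    rw [show ((m : ℤ) + 1) = ((m + 1 : ℕ) : ℤ) by push_cast; ring, zpow_natCast]
    field_simp
    ring

/-- The contour integral of `phi0`, a partial sum of binomial coefficients. -/
def a0 (n k i : ℕ) : ℂ := ∑ s ∈ Finset.range (i - 2 * k), ((n - k).choose s : ℂ)

/-- The contour integral of `phi1`, a binomial coefficient. -/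
def a1 (n k i : ℕ) : ℂ := if 2 * k ≤ i then ((n - k).choose (i - 2 * k) : ℂ) else 0

lemma contour_phi0 {ρ : ℝ} (hρ₀ : 0 < ρ) (hρ₁ : ρ < 1) (n k i : ℕ) :
    contour ρ (phi0 n k i) = a0 n k i := by
  rcases le_total (2 * k) i with h | h
  · rw [a0, ← contour_one_add_pow_div hρ₀ hρ₁]
    refine contour_congr hρ₀ fun z _ => ?_
    rw [phi0, show (i : ℤ) - 2 * k = ((i - 2 * k : ℕ) : ℤ) by omega, zpow_natCast]
  · rw [a0, Nat.sub_eq_zero_of_le h, Finset.sum_range_zero]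
    have h1 : contour ρ (phi0 n k i) =
        contour ρ (fun r => (1 + r) ^ (n - k) / (1 - r) * r ^ (2 * k - i)) := by
      refine contour_congr hρ₀ fun z hz => ?_
      have hz0 := ne_zero_of_norm_eq hρ₀ hz
      rw [phi0, show (i : ℤ) - 2 * k = -((2 * k - i : ℕ) : ℤ) by omega, zpow_neg, zpow_natCast,
        div_mul_eq_div_div, div_inv_eq_mul]
    rw [h1]
    refine contour_eq_zero hρ₀ (DifferentiableOn.mul
      (DifferentiableOn.div (by fun_prop) (by fun_prop) fun z hz h0 => ?_) (by fun_prop))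
    have hz' : ‖z‖ ≤ ρ := by simpa using hz
    rw [← sub_eq_zero.1 h0, norm_one] at hz'
    linarith

lemma contour_phi1 {ρ : ℝ} (hρ₀ : 0 < ρ) (n k i : ℕ) :
    contour ρ (phi1 n k i) = a1 n k i := by
  have := contour_one_add_pow hρ₀ (n - k) ((i : ℤ) - 2 * k)
  rw [a1]
  refine Eq.trans this ?_
  by_cases h : 2 * k ≤ i
  · rw [if_pos (by omega), if_pos h, show ((i : ℤ) - 2 * k).toNat = i - 2 * k by omega]
  · rw [if_neg (by omega), if_neg h]

lemma contour_inv_mul_sub_one {ρ : ℝ} (hρ₀ : 0 < ρ) (hρ₁ : ρ < 1) {c : ℂ} (hc : ‖c‖ ≤ 1)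
    (m : ℕ) : contour ρ (fun z => ((c * z - 1) * z ^ m)⁻¹) = if m = 0 then 0 else -c ^ (m - 1) := by
  have hcont : ∀ m : ℕ, ContinuousOn (fun z : ℂ => ((c * z - 1) * z ^ m)⁻¹)
      (Metric.sphere 0 ρ) := by
    intro m
    refine ContinuousOn.inv₀ (by fun_prop) fun z hz => ?_
    have hz' : ‖z‖ = ρ := by simpa using hz
    exact mul_ne_zero (mul_sub_one_ne_zero hc (by linarith))
      (pow_ne_zero _ (ne_zero_of_norm_eq hρ₀ hz'))
  induction m with
  | zero =>
    rw [if_pos rfl]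
    refine contour_eq_zero hρ₀ (DifferentiableOn.inv (by fun_prop) fun z hz => ?_)
    have hz' : ‖z‖ ≤ ρ := by simpa using hz
    simpa using mul_sub_one_ne_zero hc (hz'.trans_lt hρ₁)
  | succ m ih =>
    have h1 : contour ρ (fun z => c * ((c * z - 1) * z ^ m)⁻¹ - ((c * z - 1) * z ^ (m + 1))⁻¹) =
        contour ρ (fun z => z ^ (-(m : ℤ) - 1)) := by
      refine contour_congr hρ₀ fun z hz => ?_
      have h2 := ne_zero_of_norm_eq hρ₀ hz
      have h3 := mul_sub_one_ne_zero hc (z := z) (by linarith)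
      rw [show (-(m : ℤ) - 1) = -((m + 1 : ℕ) : ℤ) by push_cast; ring, zpow_neg, zpow_natCast]
      field_simp
      ring
    have hcont' : ContinuousOn (fun z : ℂ => c * ((c * z - 1) * z ^ m)⁻¹) (Metric.sphere 0 ρ) :=
      continuousOn_const.mul (hcont m)
    rw [contour_sub hρ₀ hcont' (hcont _), contour_const_mul, ih,
      contour_zpow hρ₀] at h1
    rw [if_neg (Nat.succ_ne_zero m), Nat.add_sub_cancel]
    cases m with
    | zero => simp at h1 ⊢; linear_combination -h1
    | succ m =>
      rw [if_neg (Nat.succ_ne_zero m), if_neg (by push_cast; omega), Nat.add_sub_cancel] at h1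
      rw [pow_succ]
      linear_combination -h1

/-- The double contour integral in `s₁, s₂` is the matrix of the alternating form. -/
lemma contour_contour {ρ : ℝ} (hρ₀ : 0 < ρ) (hρ₁ : ρ < 1) (l₁ l₂ : ℕ) :
    contour ρ (fun s₁ => contour ρ (fun s₂ =>
      (s₁ - s₂) / ((s₁ * s₂ - 1) * s₁ ^ (l₁ + 1) * s₂ ^ (l₂ + 1)))) =
    (if l₂ = l₁ + 1 then 1 else 0) - (if l₁ = l₂ + 1 then 1 else 0) := by
  have h1 : ∀ s₁ : ℂ, ‖s₁‖ = ρ → contour ρ (fun s₂ =>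
      (s₁ - s₂) / ((s₁ * s₂ - 1) * s₁ ^ (l₁ + 1) * s₂ ^ (l₂ + 1))) =
      (if l₂ = 0 then 0 else 1) * s₁ ^ ((l₂ : ℤ) - l₁ - 2) - s₁ ^ ((l₂ : ℤ) - l₁) := by
    intro s hs
    have hs0 := ne_zero_of_norm_eq hρ₀ hs
    have hcont : ∀ (m : ℕ) (d : ℂ), ContinuousOn (fun z : ℂ => d * ((s * z - 1) * z ^ m)⁻¹)
        (Metric.sphere 0 ρ) := by
      intro m d
      refine continuousOn_const.mul (ContinuousOn.inv₀ (by fun_prop) fun z hz => ?_)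
      have hz' : ‖z‖ = ρ := by simpa using hz
      exact mul_ne_zero (mul_sub_one_ne_zero (by linarith) (by linarith))
        (pow_ne_zero _ (ne_zero_of_norm_eq hρ₀ hz'))
    have h2 : contour ρ (fun s₂ =>
        (s - s₂) / ((s * s₂ - 1) * s ^ (l₁ + 1) * s₂ ^ (l₂ + 1))) =
        contour ρ (fun z => (s / s ^ (l₁ + 1)) * ((s * z - 1) * z ^ (l₂ + 1))⁻¹ -
          (1 / s ^ (l₁ + 1)) * ((s * z - 1) * z ^ l₂)⁻¹) := by
      refine contour_congr hρ₀ fun z hz => ?_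
      have h2 := ne_zero_of_norm_eq hρ₀ hz
      have h3 := mul_sub_one_ne_zero (c := s) (z := z) (by linarith) (by linarith)
      field_simp
      ring
    have h4 : s ^ ((l₂ : ℤ) - l₁) = s ^ (l₂ + 1) / s ^ (l₁ + 1) := by
      rw [show (l₂ : ℤ) - l₁ = ((l₂ + 1 : ℕ) : ℤ) - ((l₁ + 1 : ℕ) : ℤ) by push_cast; ring,
        zpow_sub₀ hs0, zpow_natCast, zpow_natCast]
    rw [h2, contour_sub hρ₀ (hcont _ _) (hcont _ _), contour_const_mul, contour_const_mul,
      contour_inv_mul_sub_one hρ₀ hρ₁ (by linarith), contour_inv_mul_sub_one hρ₀ hρ₁ (by linarith),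
      if_neg (Nat.succ_ne_zero _), Nat.add_sub_cancel, h4]
    cases l₂ with
    | zero => simp
    | succ l =>
      rw [if_neg (Nat.succ_ne_zero l), if_neg (Nat.succ_ne_zero l), Nat.add_sub_cancel,
        show ((l + 1 : ℕ) : ℤ) - (l₁ : ℤ) - 2 = (l : ℤ) - ((l₁ + 1 : ℕ) : ℤ) by
          push_cast; ring, zpow_sub₀ hs0, zpow_natCast, zpow_natCast]
      field_simp
      ring
  have hc : ∀ m : ℤ, ContinuousOn (fun z : ℂ => z ^ m) (Metric.sphere 0 ρ) := fun m =>
    ContinuousOn.zpow₀ continuousOn_id _ fun z hz =>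
      Or.inl (ne_zero_of_norm_eq hρ₀ (by simpa using hz))
  have hc' : ContinuousOn (fun z : ℂ => (if l₂ = 0 then (0 : ℂ) else 1) *
      z ^ ((l₂ : ℤ) - l₁ - 2)) (Metric.sphere 0 ρ) := continuousOn_const.mul (hc _)
  rw [contour_congr hρ₀ h1, contour_sub hρ₀ hc' (hc _),
    contour_const_mul, contour_zpow hρ₀, contour_zpow hρ₀]
  congr 1
  · by_cases h : l₂ = l₁ + 1
    · rw [if_neg (by omega), if_pos (by omega), if_pos h, one_mul]
    · rw [if_neg h]
      by_cases h0 : l₂ = 0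
      · rw [if_pos h0, zero_mul]
      · rw [if_neg (show ¬((l₂ : ℤ) - l₁ - 2 = -1) by omega), mul_zero]
  · by_cases h : l₁ = l₂ + 1
    · rw [if_pos (by omega), if_pos h]
    · rw [if_neg (by omega), if_neg h]

/-! ### The kernels in terms of the alternating form -/

/-- The vector of the even vertex `(i, i)`. -/
def e0 (n i : ℕ) : ℕ → ℂ
  | 0 => -(((i + 1) % 2 : ℕ) : ℂ)
  | k + 1 => a0 n k i

/-- The vector of the odd vertex `(i, i + 1)`. -/
def e1 (n i : ℕ) : ℕ → ℂ
  | 0 => 0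
  | k + 1 => a1 n k i

/-- The elementary part of the kernel `t_n^{0,0}`. -/
def elemKernel (i j : ℕ) : ℂ :=
  (if i < j then (((i + 1) % 2 : ℕ) : ℂ) * ((j % 2 : ℕ) : ℂ) else 0)
    - (if j < i then ((i % 2 : ℕ) : ℂ) * (((j + 1) % 2 : ℕ) : ℂ) else 0)

lemma sum_sum_p_mul (n : ℕ) (G : ℕ → ℕ → ℂ) :
    ∑ k ∈ Finset.range (n + 1), ∑ l ∈ Finset.range (k + 1), p n k l * G k l =
      ∑ l ∈ Finset.range (n + 1), ∑ k ∈ Finset.range (n + 1), weight n k l * G k l := by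
  rw [Finset.sum_comm (s := Finset.range (n + 1)) (t := Finset.range (n + 1))]
  refine Finset.sum_congr rfl fun k hk => ?_
  rw [Finset.mem_range] at hk
  have : Finset.range (k + 1) ⊆ Finset.range (n + 1) := Finset.range_subset_range.2 (by omega)
  rw [← Finset.sum_subset this]
  · refine Finset.sum_congr rfl fun l hl => ?_
    rw [weight, if_pos (Nat.lt_succ_iff.1 (Finset.mem_range.1 hl))]
  · intro l _ hl
    rw [weight, if_neg (by simpa using hl), zero_mul]

lemma quad_eq {ρ : ℝ} (hρ₀ : 0 < ρ) (hρ₁ : ρ < 1) (n : ℕ) {f g : ℕ → ℕ → ℕ → ℂ → ℂ}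
    (i j : ℕ) {X Y : ℕ → ℂ} (hf : ∀ k, contour ρ (f n k i) = X (k + 1))
    (hg : ∀ k, contour ρ (g n k j) = Y (k + 1)) :
    quad ρ n f g i j = form n X Y - X 0 * coord n 1 Y + coord n 1 X * Y 0 := by
  let s : ℕ → ℕ → ℂ := fun l₁ l₂ =>
    (if l₂ = l₁ + 1 then 1 else 0) - (if l₁ = l₂ + 1 then 1 else 0)
  have h1 : quad ρ n f g i j = ∑ k₁ ∈ Finset.range (n + 1), ∑ l₁ ∈ Finset.range (k₁ + 1),
      p n k₁ l₁ * (X (k₁ + 1) * ∑ k₂ ∈ Finset.range (n + 1), ∑ l₂ ∈ Finset.range (k₂ + 1),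
        p n k₂ l₂ * (Y (k₂ + 1) * s l₁ l₂)) := by
    rw [quad]
    refine Finset.sum_congr rfl fun k₁ _ => Finset.sum_congr rfl fun l₁ _ => ?_
    rw [Finset.mul_sum, Finset.mul_sum]
    refine Finset.sum_congr rfl fun k₂ _ => ?_
    rw [Finset.mul_sum, Finset.mul_sum]
    refine Finset.sum_congr rfl fun l₂ _ => ?_
    have h2 : ∀ r₁ r₂ : ℂ, contour ρ (fun s₁ => contour ρ (fun s₂ => f n k₁ i r₁ * g n k₂ j r₂ *
        ((s₁ - s₂) / ((s₁ * s₂ - 1) * s₁ ^ (l₁ + 1) * s₂ ^ (l₂ + 1))))) =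
        f n k₁ i r₁ * (s l₁ l₂ * g n k₂ j r₂) := by
      intro r₁ r₂
      simp only [contour_const_mul]
      rw [contour_contour hρ₀ hρ₁]
      ring
    have h3 : ∀ r₁ : ℂ, contour ρ (fun r₂ => contour ρ (fun s₁ => contour ρ (fun s₂ =>
        f n k₁ i r₁ * g n k₂ j r₂ *
          ((s₁ - s₂) / ((s₁ * s₂ - 1) * s₁ ^ (l₁ + 1) * s₂ ^ (l₂ + 1)))))) =
        s l₁ l₂ * contour ρ (g n k₂ j) * f n k₁ i r₁ := by
      intro r₁
      rw [congrArg (contour ρ) (funext (h2 r₁)), contour_const_mul, contour_const_mul]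
      ring
    rw [congrArg (contour ρ) (funext h3), contour_const_mul, hf, hg]
    ring
  have h2 : ∀ l₁, ∑ k₂ ∈ Finset.range (n + 1), ∑ l₂ ∈ Finset.range (k₂ + 1),
      p n k₂ l₂ * (Y (k₂ + 1) * s l₁ l₂) =
      ∑ l₂ ∈ Finset.range (n + 1), s l₁ l₂ * coord n (l₂ + 1) Y := by
    intro l₁
    rw [sum_sum_p_mul n fun k₂ l₂ => Y (k₂ + 1) * s l₁ l₂]
    refine Finset.sum_congr rfl fun l₂ _ => ?_
    rw [coord_succ, Finset.mul_sum]
    exact Finset.sum_congr rfl fun k _ => by ring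
  have h3 : quad ρ n f g i j = ∑ l₁ ∈ Finset.range (n + 1), ∑ l₂ ∈ Finset.range (n + 1),
      ((if l₂ = l₁ + 1 then coord n (l₁ + 1) X * coord n (l₂ + 1) Y else 0) -
        (if l₁ = l₂ + 1 then coord n (l₁ + 1) X * coord n (l₂ + 1) Y else 0)) := by
    simp only [h1, h2]
    rw [sum_sum_p_mul n fun k₁ l₁ =>
      X (k₁ + 1) * ∑ l₂ ∈ Finset.range (n + 1), s l₁ l₂ * coord n (l₂ + 1) Y]
    refine Finset.sum_congr rfl fun l₁ _ => ?_
    have h4 : ∑ k ∈ Finset.range (n + 1), weight n k l₁ *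
        (X (k + 1) * ∑ l₂ ∈ Finset.range (n + 1), s l₁ l₂ * coord n (l₂ + 1) Y) =
        coord n (l₁ + 1) X * ∑ l₂ ∈ Finset.range (n + 1), s l₁ l₂ * coord n (l₂ + 1) Y := by
      rw [coord_succ n l₁ X, Finset.sum_mul]
      exact Finset.sum_congr rfl fun k _ => by ring
    rw [h4, Finset.mul_sum]
    refine Finset.sum_congr rfl fun l₂ _ => ?_
    simp only [s]
    split_ifs <;> ring
  have h5 : ∀ Z W : ℕ → ℂ, ∀ l ∈ Finset.range (n + 1), (∑ m ∈ Finset.range (n + 1),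
      if m = l + 1 then coord n (l + 1) Z * coord n (m + 1) W else 0) =
      coord n (l + 1) Z * coord n (l + 2) W := by
    intro Z W l _
    rw [Finset.sum_ite_eq' _ (l + 1)]
    split_ifs with h
    · rfl
    · rw [coord_of_lt (by simpa using h) W, mul_zero]
  have h6 : ∑ l₁ ∈ Finset.range (n + 1), ∑ l₂ ∈ Finset.range (n + 1),
      (if l₁ = l₂ + 1 then coord n (l₁ + 1) X * coord n (l₂ + 1) Y else 0) =
      ∑ l ∈ Finset.range (n + 1), coord n (l + 1) Y * coord n (l + 2) X := by
    rw [Finset.sum_comm, ← Finset.sum_congr rfl (h5 Y X)]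
    exact Finset.sum_congr rfl fun _ _ => Finset.sum_congr rfl fun _ _ => by
      split_ifs
      · ring
      · rfl
  have h7 : ∀ Z W : ℕ → ℂ, ∑ l ∈ Finset.range (n + 1), coord n (l + 1) Z * coord n (l + 2) W =
      ∑ L ∈ Finset.range (n + 1), coord n L Z * coord n (L + 1) W - Z 0 * coord n 1 W := by
    intro Z W
    rw [Finset.sum_range_succ, coord_of_lt (Nat.lt_succ_self n) W,
      Finset.sum_range_succ' (fun L => coord n L Z * coord n (L + 1) W), coord_zero]
    ring
  rw [h3]
  simp only [Finset.sum_sub_distrib]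
  rw [h6, Finset.sum_congr rfl (h5 X Y), h7, h7, form_apply, Finset.sum_sub_distrib,
    Finset.sum_congr rfl fun L _ => mul_comm (coord n (L + 1) X) (coord n L Y)]
  ring

lemma h0_eq {ρ : ℝ} (hρ₀ : 0 < ρ) (hρ₁ : ρ < 1) (n i : ℕ) :
    h0 ρ n i = coord n 0 (e0 n i) + coord n 1 (e0 n i) := by
  have : ∀ k, contour ρ (fun r => phi0 n k i r) = a0 n k i :=
    fun k => contour_phi0 hρ₀ hρ₁ n k i
  simp only [h0, this, coord_zero, coord_succ, weight, e0, Nat.zero_le, if_true]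

lemma h1_eq {ρ : ℝ} (hρ₀ : 0 < ρ) (n i : ℕ) :
    h1 ρ n i = coord n 0 (e1 n i) + coord n 1 (e1 n i) := by
  have : ∀ k, contour ρ (fun r => phi1 n k i r) = a1 n k i :=
    fun k => contour_phi1 hρ₀ n k i
  simp only [h1, this, coord_zero, coord_succ, weight, e1, Nat.zero_le, if_true, zero_add]

lemma t00_eq {ρ : ℝ} (hρ₀ : 0 < ρ) (hρ₁ : ρ < 1) (n i j : ℕ) :
    t00 ρ n i j = elemKernel i j + form n (e0 n i) (e0 n j) := by
  rw [t00, quad_eq hρ₀ hρ₁ n i j (X := e0 n i) (Y := e0 n j)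
    (fun k => contour_phi0 hρ₀ hρ₁ n k i) (fun k => contour_phi0 hρ₀ hρ₁ n k j),
    h0_eq hρ₀ hρ₁, h0_eq hρ₀ hρ₁, elemKernel]
  simp only [coord_zero, e0]
  ring

lemma t10_eq {ρ : ℝ} (hρ₀ : 0 < ρ) (hρ₁ : ρ < 1) (n i j : ℕ) :
    t10 ρ n i j = form n (e1 n i) (e0 n j) := by
  rw [t10, quad_eq hρ₀ hρ₁ n i j (X := e1 n i) (Y := e0 n j)
    (fun k => contour_phi1 hρ₀ n k i) (fun k => contour_phi0 hρ₀ hρ₁ n k j), h1_eq hρ₀]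
  simp only [coord_zero, e0, e1]
  ring

lemma t01_eq {ρ : ℝ} (hρ₀ : 0 < ρ) (hρ₁ : ρ < 1) (n i j : ℕ) :
    t01 ρ n i j = form n (e0 n i) (e1 n j) := by
  rw [t01, quad_eq hρ₀ hρ₁ n i j (X := e0 n i) (Y := e1 n j)
    (fun k => contour_phi0 hρ₀ hρ₁ n k i) (fun k => contour_phi1 hρ₀ n k j), h1_eq hρ₀]
  simp only [coord_zero, e0, e1]
  ring

lemma t11_eq {ρ : ℝ} (hρ₀ : 0 < ρ) (hρ₁ : ρ < 1) (n i j : ℕ) :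
    t11 ρ n i j = form n (e1 n i) (e1 n j) := by
  rw [t11, quad_eq hρ₀ hρ₁ n i j (X := e1 n i) (Y := e1 n j)
    (fun k => contour_phi1 hρ₀ n k i) (fun k => contour_phi1 hρ₀ n k j)]
  simp only [e1]
  ring

/-! ### Propagation from the diagonal -/

lemma binom_natCast (m l : ℕ) : binom m l = (m.choose l : ℂ) := by
  rw [binom, Ring.choose_natCast]; simp

lemma binom_zero_right (m : ℤ) : binom m 0 = 1 := by simp [binom]

lemma binom_add_one_succ (m : ℤ) (l : ℕ) :
    binom (m + 1) (l + 1) = binom m l + binom m (l + 1) := by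
  rw [binom, binom, binom, Ring.choose_succ_succ]; push_cast; rfl

section Ext

variable {V W : Type*} [AddCommGroup V] [Module ℂ V] [AddCommGroup W] [Module ℂ W]

/-- The values at the even vertices `(i, i + 2m)` which are determined by the values `u i` at the
diagonal vertices `(i, i)` and the equations at the odd vertices. -/
def ext0 (u : ℕ → V) (i m : ℕ) : V :=
  ∑ l ∈ Finset.range (m + 1), ((-1) ^ m * binom m l) • u (i + l)

/-- The values at the odd vertices `(i, i + 2m + 1)` which are determined by the values `v i` at
the vertices `(i, i + 1)` and the equations at the even vertices off the diagonal. -/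
def ext1 (v : ℕ → V) (i m : ℕ) : V :=
  ∑ l ∈ Finset.range (i + 1), ((-1) ^ m * (-1) ^ l * binom ((m : ℤ) - 1 + l) l) • v (i - l)

lemma map_ext0 (f : V →ₗ[ℂ] W) (u : ℕ → V) (i m : ℕ) :
    f (ext0 u i m) = ext0 (fun a => f (u a)) i m := by
  simp only [ext0, map_sum, map_smul]

lemma map_ext1 (f : V →ₗ[ℂ] W) (v : ℕ → V) (i m : ℕ) :
    f (ext1 v i m) = ext1 (fun a => f (v a)) i m := by
  simp only [ext1, map_sum, map_smul]

lemma ext0_zero (u : ℕ → V) (i : ℕ) : ext0 u i 0 = u i := by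
  simp [ext0, binom_zero_right]

lemma ext1_zero (v : ℕ → V) (i : ℕ) : ext1 v i 0 = v i := by
  rw [ext1, Finset.sum_range_succ', Finset.sum_eq_zero]
  · simp [binom_zero_right]
  · intro l _
    have : binom (((0 : ℕ) : ℤ) - 1 + ((l + 1 : ℕ) : ℤ)) (l + 1) = 0 := by
      rw [show ((0 : ℕ) : ℤ) - 1 + ((l + 1 : ℕ) : ℤ) = (l : ℤ) by push_cast; ring, binom_natCast,
        Nat.choose_succ_self, Nat.cast_zero]
    rw [this, mul_zero, zero_smul]

lemma ext0_add (u v : ℕ → V) (i m : ℕ) :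
    ext0 (fun a => u a + v a) i m = ext0 u i m + ext0 v i m := by
  simp only [ext0, smul_add, Finset.sum_add_distrib]

lemma ext0_succ (u : ℕ → V) (i m : ℕ) :
    ext0 u i (m + 1) = -(ext0 u i m + ext0 u (i + 1) m) := by
  have h : ext0 u i m = ((-1) ^ m * binom m 0) • u i +
      ∑ l ∈ Finset.range (m + 1), ((-1) ^ m * binom m (l + 1)) • u (i + (l + 1)) := by
    rw [Finset.sum_range_succ _ m, binom_natCast m (m + 1), Nat.choose_succ_self, ext0,
      Finset.sum_range_succ']
    simp only [add_zero, Nat.cast_zero, mul_zero, zero_smul]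
    rw [add_comm]
  rw [h, ext0, ext0, Finset.sum_range_succ', add_assoc, ← Finset.sum_add_distrib, neg_add,
    ← Finset.sum_neg_distrib, add_comm]
  congr 1
  · rw [binom_zero_right, binom_zero_right, ← neg_smul, pow_succ, add_zero]; congr 1; ring
  · refine Finset.sum_congr rfl fun l _ => ?_
    rw [show i + 1 + l = i + (l + 1) by ring, ← add_smul, ← neg_smul, Nat.cast_succ,
      binom_add_one_succ]
    congr 1
    ring

lemma ext0_succ' (u : ℕ → V) (i m : ℕ) :
    ext0 u i (m + 1) = -ext0 (fun a => u a + u (a + 1)) i m := by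
  have : ext0 (fun a => u (a + 1)) i m = ext0 u (i + 1) m :=
    Finset.sum_congr rfl fun l _ => by simp only [show i + l + 1 = i + 1 + l by ring]
  rw [ext0_succ, ext0_add, this]

lemma ext1_zero_succ (v : ℕ → V) (m : ℕ) : ext1 v 0 (m + 1) = -ext1 v 0 m := by
  simp [ext1, binom_zero_right, pow_succ]

lemma ext1_succ_succ (v : ℕ → V) (i m : ℕ) :
    ext1 v (i + 1) (m + 1) = -(ext1 v i (m + 1) + ext1 v (i + 1) m) := by
  rw [ext1, ext1, ext1, Finset.sum_range_succ', Finset.sum_range_succ' _ (i + 1), ← add_assoc,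
    ← Finset.sum_add_distrib, neg_add, ← Finset.sum_neg_distrib]
  congr 1
  · refine Finset.sum_congr rfl fun l _ => ?_
    rw [show i + 1 - (l + 1) = i - l by omega, ← add_smul, ← neg_smul,
      show ((m + 1 : ℕ) : ℤ) - 1 + ((l + 1 : ℕ) : ℤ) = ((m : ℤ) + l) + 1 by push_cast; ring,
      show ((m + 1 : ℕ) : ℤ) - 1 + (l : ℤ) = (m : ℤ) + l by push_cast; ring,
      show (m : ℤ) - 1 + ((l + 1 : ℕ) : ℤ) = (m : ℤ) + l by push_cast; ring, binom_add_one_succ]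
    congr 1
    ring
  · rw [binom_zero_right, binom_zero_right, ← neg_smul]
    congr 1
    ring

lemma ext0_eq_of_rec {u : ℕ → V} {w : ℕ → ℕ → V} (h0 : ∀ i, w i 0 = u i)
    (h1 : ∀ i m, w i (m + 1) = -(w i m + w (i + 1) m)) (i m : ℕ) : ext0 u i m = w i m := by
  induction m generalizing i with
  | zero => rw [ext0_zero, h0]
  | succ m ih => rw [ext0_succ, h1, ih, ih]

lemma ext1_eq_of_rec {v : ℕ → V} {w : ℕ → ℕ → V} (h0 : ∀ i, w i 0 = v i)
    (h1 : ∀ m, w 0 (m + 1) = -w 0 m)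
    (h2 : ∀ i m, w (i + 1) (m + 1) = -(w i (m + 1) + w (i + 1) m)) (i m : ℕ) :
    ext1 v i m = w i m := by
  induction m generalizing i with
  | zero => rw [ext1_zero, h0]
  | succ m ih =>
    induction i with
    | zero => rw [ext1_zero_succ, h1, ih]
    | succ i ih' => rw [ext1_succ_succ, h2, ih, ih']

lemma ext0_ext0_comm (F : ℕ → ℕ → V) (i m j q : ℕ) :
    ext0 (fun a => ext0 (F a) j q) i m = ext0 (fun b => ext0 (fun a => F a b) i m) j q := by
  simp only [ext0, Finset.smul_sum]
  rw [Finset.sum_comm]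
  exact Finset.sum_congr rfl fun l _ => Finset.sum_congr rfl fun l' _ => smul_comm _ _ _

end Ext

lemma ext0_const (c : ℂ) (i m : ℕ) : ext0 (fun _ => c) i m = (-1) ^ m * 2 ^ m * c :=
  ext0_eq_of_rec (w := fun _ m => (-1) ^ m * 2 ^ m * c) (fun _ => by simp)
    (fun _ _ => by ring) i m

lemma natCast_mod_two_add (i : ℕ) : (((i % 2 : ℕ) : ℂ)) + (((i + 1) % 2 : ℕ) : ℂ) = 1 := by
  rcases Nat.mod_two_eq_zero_or_one i with h | h
  · rw [h, show (i + 1) % 2 = 1 by omega]; norm_num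
  · rw [h, show (i + 1) % 2 = 0 by omega]; norm_num

lemma ext0_a0 (n k i m : ℕ) :
    ext0 (a0 n k) i m =
      (-1) ^ m * ∑ s ∈ Finset.range (i + m - 2 * k), ((n - k + m).choose s : ℂ) := by
  refine ext0_eq_of_rec (w := fun i m => (-1) ^ m *
    ∑ s ∈ Finset.range (i + m - 2 * k), ((n - k + m).choose s : ℂ)) (fun i => ?_)
    (fun i m => ?_) i m
  · simp [a0]
  · rcases lt_or_ge (i + m) (2 * k) with h | h
    · rw [show i + (m + 1) - 2 * k = 0 by omega, show i + m - 2 * k = 0 by omega,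
        show i + 1 + m - 2 * k = 0 by omega]
      simp
    · obtain ⟨r, hr⟩ := Nat.exists_eq_add_of_le h
      rw [show i + (m + 1) - 2 * k = r + 1 by omega, show i + m - 2 * k = r by omega,
        show i + 1 + m - 2 * k = r + 1 by omega, ← add_assoc, sum_range_choose_succ]
      ring

lemma ext1_a1 {n k : ℕ} (hk : k ≤ n) (i m : ℕ) :
    ext1 (a1 n k) i m =
      if 2 * k ≤ i then (-1) ^ m * binom ((n : ℤ) - k - m) (i - 2 * k) else 0 := by
  refine ext1_eq_of_rec (w := fun i m =>
    if 2 * k ≤ i then (-1) ^ m * binom ((n : ℤ) - k - m) (i - 2 * k) else 0) (fun i => ?_)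
    (fun m => ?_) (fun i m => ?_) i m
  · simp only [a1, pow_zero, one_mul]
    rw [show (n : ℤ) - k - ((0 : ℕ) : ℤ) = ((n - k : ℕ) : ℤ) by push_cast [hk]; ring,
      binom_natCast]
  · split_ifs
    · rw [Nat.zero_sub, binom_zero_right, binom_zero_right]; ring
    · simp
  · rcases lt_trichotomy (2 * k) (i + 1) with h | h | h
    · obtain ⟨r, rfl⟩ := Nat.exists_eq_add_of_le (Nat.lt_succ_iff.1 h)
      have h1 := binom_add_one_succ ((n : ℤ) - k - ((m + 1 : ℕ) : ℤ)) r
      rw [show (n : ℤ) - k - ((m + 1 : ℕ) : ℤ) + 1 = n - k - m by push_cast; ring] at h1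
      rw [if_pos (by omega), if_pos (by omega), if_pos (by omega),
        show 2 * k + r + 1 - 2 * k = r + 1 by omega, show 2 * k + r - 2 * k = r by omega, h1]
      ring
    · rw [if_pos h.le, if_neg (by omega), if_pos h.le, h, Nat.sub_self, binom_zero_right,
        binom_zero_right]
      ring
    · rw [if_neg (by omega), if_neg (by omega), if_neg (by omega)]
      simp

/-! ### The equations satisfied by the vectors of the vertices -/

lemma ext0_apply (u : ℕ → ℕ → ℂ) (i m c : ℕ) :
    ext0 u i m c = ext0 (fun a => u a c) i m :=
  map_ext0 (LinearMap.proj c : (ℕ → ℂ) →ₗ[ℂ] ℂ) u i m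

lemma ext1_apply (u : ℕ → ℕ → ℂ) (i m c : ℕ) :
    ext1 u i m c = ext1 (fun a => u a c) i m :=
  map_ext1 (LinearMap.proj c : (ℕ → ℂ) →ₗ[ℂ] ℂ) u i m

lemma ext1_e1_zero (n i m : ℕ) : ext1 (e1 n) i m 0 = 0 := by
  rw [ext1_apply]; simp [ext1, e1]

lemma ext1_e1_succ (n i m k : ℕ) : ext1 (e1 n) i m (k + 1) = ext1 (a1 n k) i m := ext1_apply ..

lemma ext0_e0_succ (n i m k : ℕ) : ext0 (e0 n) i m (k + 1) = ext0 (a0 n k) i m := ext0_apply ..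

/-- The extension of `e0` to the virtual vertex `(2k, 2n + 2)`; only its components with index at
most `n + 1` matter. -/
lemma ext0_e0_boundary {n k : ℕ} (hk : k ≤ n) {c : ℕ} (hc : c ≤ n + 1) :
    ext0 (e0 n) (2 * k) (n + 1 - k) c = (-1) ^ (n + 1 - k) * bdry n k c := by
  cases c with
  | zero =>
    rw [ext0_apply, show n + 1 - k = (n - k) + 1 by omega, ext0_succ']
    have : (fun a => e0 n a 0 + e0 n (a + 1) 0) = fun _ => (-1 : ℂ) := by
      funext a
      have := natCast_mod_two_add (a + 1)
      simp only [e0]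
      linear_combination -this
    rw [this, ext0_const, bdry]
    ring
  | succ k' =>
    rw [ext0_e0_succ, ext0_a0, bdry, binomSum,
      show 2 * k + (n + 1 - k) - 2 * k' = n + k + 1 - 2 * k' by omega,
      show n - k' + (n + 1 - k) = 2 * n + 1 - k - k' by omega]

lemma ext1_a1_eq_zero {n i m k : ℕ} (hk : k ≤ n) (h : i + 2 * m = 2 * n + 1) :
    ext1 (a1 n k) i m = 0 := by
  rw [ext1_a1 hk]
  split_ifs with h1
  · rw [show (n : ℤ) - k - m = ((n - k - m : ℕ) : ℤ) by omega, binom_natCast,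
      Nat.choose_eq_zero_of_lt (by omega), Nat.cast_zero, mul_zero]
  · rfl

/-- The form only depends on the components with index at most `n + 1`. -/
lemma form_congr {n : ℕ} {X X' : ℕ → ℂ} (h : ∀ c ≤ n + 1, X c = X' c) (Y : ℕ → ℂ) :
    form n X Y = form n X' Y := by
  have : ∀ L, coord n L X = coord n L X' := by
    intro L
    cases L with
    | zero => exact h 0 (by omega)
    | succ l =>
      rw [coord_succ, coord_succ]
      exact Finset.sum_congr rfl fun k hk => by rw [h _ (by simpa using hk)]
  simp only [form_apply, this]

lemma e1_add_e1_add_e0 (n i : ℕ) : e1 n i + e1 n (i + 1) + e0 n i = e0 n (i + 2) := by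
  funext c
  cases c with
  | zero =>
    simp only [Pi.add_apply, e0, e1, zero_add]
    rw [show (i + 2 + 1) % 2 = (i + 1) % 2 by omega]
  | succ k =>
    simp only [Pi.add_apply, e0, e1, a0, a1]
    rcases lt_trichotomy (2 * k) (i + 1) with h | h | h
    · obtain ⟨r, rfl⟩ := Nat.exists_eq_add_of_le (Nat.lt_succ_iff.1 h)
      rw [if_pos (by omega), if_pos (by omega), show 2 * k + r + 2 - 2 * k = r + 1 + 1 by omega,
        show 2 * k + r - 2 * k = r by omega, show 2 * k + r + 1 - 2 * k = r + 1 by omega,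
        Finset.sum_range_succ, Finset.sum_range_succ]
      ring
    · rw [if_neg (by omega), if_pos h.le, show i + 2 - 2 * k = 1 by omega,
        show i - 2 * k = 0 by omega, show i + 1 - 2 * k = 0 by omega]
      simp
    · rw [if_neg (by omega), if_neg (by omega), show i + 2 - 2 * k = 0 by omega,
        show i - 2 * k = 0 by omega]
      simp

lemma e1_zero_eq_e0_one (n : ℕ) : e1 n 0 = e0 n 1 := by
  funext c
  cases c with
  | zero => simp [e0, e1]
  | succ k =>
    simp only [e0, e1, a0, a1]
    rcases Nat.eq_zero_or_pos k with rfl | h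
    · simp
    · rw [if_neg (by omega), show 1 - 2 * k = 0 by omega, Finset.sum_range_zero]

lemma weight_self {n l : ℕ} (h : l ≤ n) : weight n n l = (-1) ^ n := by
  rw [weight, if_pos h, p_self h]

lemma coord_self_succ (n : ℕ) (Y : ℕ → ℂ) : coord n (n + 1) Y = (-1) ^ n * Y (n + 1) := by
  rw [coord_succ, Finset.sum_range_succ, Finset.sum_eq_zero, zero_add, weight_self le_rfl]
  intro k hk
  rw [weight, if_neg (by simpa using hk), zero_mul]

lemma coord_succ_e0_two_mul {n l : ℕ} (hl : l ≤ n) :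
    coord n (l + 1) (e0 n (2 * n)) = powSum n l - (-1) ^ n := by
  have h : ∀ k ∈ Finset.range (n + 1), weight n k l * e0 n (2 * n) (k + 1) =
      weight n k l * 2 ^ (n - k) - if k = n then weight n n l else 0 := by
    intro k hk
    have hk' : k ≤ n := Nat.lt_succ_iff.1 (Finset.mem_range.1 hk)
    rw [e0, a0]
    rcases hk'.eq_or_lt with rfl | hk'
    · simp
    · rw [if_neg hk'.ne, ← Finset.sum_subset (Finset.range_subset_range.2
        (show n - k + 1 ≤ 2 * n - 2 * k by omega)), ← Nat.cast_sum, Nat.sum_range_choose]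
      · push_cast; ring
      · intro s _ hs
        rw [Finset.mem_range, not_lt] at hs
        rw [Nat.choose_eq_zero_of_lt (by omega), Nat.cast_zero]
  rw [coord_succ, Finset.sum_congr rfl h, Finset.sum_sub_distrib, sum_weight_mul_two_pow,
    Finset.sum_ite_eq' _ n, if_pos (Finset.self_mem_range_succ n), weight_self hl]

lemma coord_succ_e1_two_mul {n l : ℕ} (hl : l ≤ n) :
    coord n (l + 1) (e1 n (2 * n)) = (-1) ^ n := by
  rw [coord_succ, Finset.sum_range_succ, Finset.sum_eq_zero, weight_self hl]
  · simp [e1, a1]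
  · intro k hk
    rw [Finset.mem_range] at hk
    rw [e1, a1, if_pos (by omega), Nat.choose_eq_zero_of_lt (by omega), Nat.cast_zero, mul_zero]

/-- Pairing with the vector of the vertex `(2n, 2n)`; the form telescopes. -/
lemma form_e0_two_mul (n : ℕ) (Y : ℕ → ℂ) :
    form n (e0 n (2 * n)) Y =
      -Y (n + 1) - if Even n then 0 else coord n 0 Y + coord n 1 Y := by
  rcases Nat.even_or_odd n with hn | hn
  · have hx : ∀ L ≤ n + 1, coord n L (e0 n (2 * n)) = -if Even L then 1 else 0 := by
      intro L hL
      cases L with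
      | zero => simp [coord_zero, e0]
      | succ l =>
        rw [coord_succ_e0_two_mul (by omega), powSum, hn.neg_one_pow]
        by_cases h : Even l
        · rw [if_pos ⟨by omega, (Nat.even_sub (by omega)).2 (by tauto)⟩, h.neg_one_pow,
            if_neg (by rw [Nat.even_add_one]; tauto)]
          ring
        · rw [if_neg (fun h' => h ((Nat.even_sub (by omega)).1 h'.2 |>.1 hn)),
            if_pos (by rw [Nat.even_add_one]; exact h)]
          ring
    have hs : ∀ L ∈ Finset.range (n + 1), coord n L (e0 n (2 * n)) * coord n (L + 1) Y -
        coord n (L + 1) (e0 n (2 * n)) * coord n L Y =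
        (if Even (L + 1) then 0 else -coord n (L + 1) Y) -
          (if Even L then 0 else -coord n L Y) := by
      intro L hL
      rw [Finset.mem_range] at hL
      rw [hx L (by omega), hx (L + 1) (by omega)]
      by_cases h : Even L
      · rw [if_pos h, if_pos h, if_neg (by rw [Nat.even_add_one]; tauto),
          if_neg (by rw [Nat.even_add_one]; tauto)]
        ring
      · rw [if_neg h, if_neg h, if_pos (by rw [Nat.even_add_one]; tauto),
          if_pos (by rw [Nat.even_add_one]; tauto)]
        ring
    rw [form_apply, Finset.sum_congr rfl hs,
      Finset.sum_range_sub (fun L => if Even L then 0 else -coord n L Y),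
      if_neg (by rw [Nat.even_add_one]; tauto), if_pos Even.zero, if_pos hn, coord_self_succ,
      hn.neg_one_pow]
    ring
  · have hn' : ¬Even n := Nat.not_even_iff_odd.2 hn
    have hx : ∀ L ≤ n + 1, coord n L (e0 n (2 * n)) =
        (if Even L then 0 else 1) - if L = 0 then 1 else 0 := by
      intro L hL
      cases L with
      | zero => simp [coord_zero, e0]
      | succ l =>
        rw [coord_succ_e0_two_mul (by omega), powSum, hn.neg_one_pow, if_neg (Nat.succ_ne_zero l)]
        by_cases h : Even l
        · rw [if_neg (fun h' => hn' ((Nat.even_sub (by omega)).1 h'.2 |>.2 h)),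
            if_neg (by rw [Nat.even_add_one]; tauto)]
          ring
        · rw [if_pos ⟨by omega, (Nat.even_sub (by omega)).2 (by tauto)⟩,
            (Nat.not_even_iff_odd.1 h).neg_one_pow,
            if_pos (by rw [Nat.even_add_one]; exact h)]
          ring
    have hs : ∀ L ∈ Finset.range (n + 1), coord n L (e0 n (2 * n)) * coord n (L + 1) Y -
        coord n (L + 1) (e0 n (2 * n)) * coord n L Y =
        ((if Even (L + 1) then coord n (L + 1) Y else 0) -
          (if Even L then coord n L Y else 0)) - if L = 0 then coord n 1 Y else 0 := by
      intro L hL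
      rw [Finset.mem_range] at hL
      rw [hx L (by omega), hx (L + 1) (by omega), if_neg (Nat.succ_ne_zero L)]
      by_cases h : Even L
      · have h' : ¬Even (L + 1) := by rw [Nat.even_add_one]; tauto
        simp only [h, h', if_true, if_false]
        split_ifs with h0
        · subst h0; ring
        · ring
      · have h' : Even (L + 1) := by rw [Nat.even_add_one]; exact h
        have h0 : L ≠ 0 := by rintro rfl; exact h Even.zero
        simp only [h, h', h0, if_true, if_false]
        ring
    rw [form_apply, Finset.sum_congr rfl hs, Finset.sum_sub_distrib,
      Finset.sum_range_sub (fun L => if Even L then coord n L Y else 0),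
      if_pos (by rw [Nat.even_add_one]; tauto), if_pos Even.zero, if_neg hn', coord_self_succ,
      hn.neg_one_pow, Finset.sum_ite_eq' _ 0, if_pos (Finset.mem_range.2 n.succ_pos)]
    ring

/-- Pairing with the vector of the vertex `(2n, 2n + 1)`; the form telescopes. -/
lemma form_e1_two_mul (n : ℕ) (Y : ℕ → ℂ) :
    form n (e1 n (2 * n)) Y = Y (n + 1) - (-1) ^ n * (coord n 0 Y + coord n 1 Y) := by
  have hx : ∀ L ≤ n + 1, coord n L (e1 n (2 * n)) =
      (-1) ^ n * (1 - if L = 0 then 1 else 0) := by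
    intro L hL
    cases L with
    | zero => simp [coord_zero, e1]
    | succ l => rw [coord_succ_e1_two_mul (by omega), if_neg (Nat.succ_ne_zero l)]; ring
  have hs : ∀ L ∈ Finset.range (n + 1), coord n L (e1 n (2 * n)) * coord n (L + 1) Y -
      coord n (L + 1) (e1 n (2 * n)) * coord n L Y =
      (-1) ^ n * (coord n (L + 1) Y - coord n L Y) -
        if L = 0 then (-1) ^ n * coord n 1 Y else 0 := by
    intro L hL
    rw [Finset.mem_range] at hL
    rw [hx L (by omega), hx (L + 1) (by omega), if_neg (Nat.succ_ne_zero L)]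
    split_ifs with h0
    · subst h0; ring
    · ring
  have sq : ((-1 : ℂ) ^ n) * (-1) ^ n = 1 := by rw [← mul_pow]; norm_num
  rw [form_apply, Finset.sum_congr rfl hs, Finset.sum_sub_distrib, ← Finset.mul_sum,
    Finset.sum_range_sub (fun L => coord n L Y), Finset.sum_ite_eq' _ 0,
    if_pos (Finset.mem_range.2 n.succ_pos), coord_self_succ]
  linear_combination Y (n + 1) * sq

/-! ### The elementary part of the inverse -/

lemma elemKernel_sub (i j : ℕ) :
    elemKernel i j - elemKernel (i + 2) j = if j = i + 1 then 1 else 0 := by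
  rw [elemKernel, elemKernel, show (i + 2 + 1) % 2 = (i + 1) % 2 by omega,
    show (i + 2) % 2 = i % 2 by omega]
  rcases Nat.mod_two_eq_zero_or_one i with h | h <;>
  rcases Nat.mod_two_eq_zero_or_one j with h' | h' <;>
  [rw [h, h', show (i + 1) % 2 = 1 by omega, show (j + 1) % 2 = 1 by omega];
   rw [h, h', show (i + 1) % 2 = 1 by omega, show (j + 1) % 2 = 0 by omega];
   rw [h, h', show (i + 1) % 2 = 0 by omega, show (j + 1) % 2 = 1 by omega];
   rw [h, h', show (i + 1) % 2 = 0 by omega, show (j + 1) % 2 = 0 by omega]] <;>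
  split_ifs <;> first | (exfalso; omega) | norm_num

lemma elemKernel_one (j : ℕ) : -elemKernel 1 j = if j = 0 then 1 else 0 := by
  rw [elemKernel]
  rcases Nat.eq_zero_or_pos j with rfl | h
  · norm_num
  · rw [if_neg (show ¬j < 1 by omega), if_neg h.ne']
    norm_num

lemma elemKernel_add (i j : ℕ) :
    elemKernel i j + elemKernel (i + 1) j =
      (if i < j then 1 else 0) - (((j + 1) % 2 : ℕ) : ℂ) := by
  rw [elemKernel, elemKernel, show (i + 1 + 1) % 2 = i % 2 by omega]
  rcases Nat.mod_two_eq_zero_or_one i with h | h <;>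
  rcases Nat.mod_two_eq_zero_or_one j with h' | h' <;>
  [rw [h, h', show (i + 1) % 2 = 1 by omega, show (j + 1) % 2 = 1 by omega];
   rw [h, h', show (i + 1) % 2 = 1 by omega, show (j + 1) % 2 = 0 by omega];
   rw [h, h', show (i + 1) % 2 = 0 by omega, show (j + 1) % 2 = 1 by omega];
   rw [h, h', show (i + 1) % 2 = 0 by omega, show (j + 1) % 2 = 0 by omega]] <;>
  split_ifs <;> first | (exfalso; omega) | norm_num

lemma ext0_elemKernel_boundary {n k : ℕ} (hk : k ≤ n) (j : ℕ) :
    ext0 (fun a => elemKernel a j) (2 * k) (n + 1 - k) =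
      (-1) ^ (n + 1 - k) * (a0 n k j + 2 ^ (n - k) * e0 n j 0) := by
  have h1 : (fun a => elemKernel a j + elemKernel (a + 1) j) =
      fun a => (if a < j then (1 : ℂ) else 0) + e0 n j 0 := by
    funext a; rw [elemKernel_add, e0]; ring
  have h2 : ext0 (fun a => if a < j then (1 : ℂ) else 0) (2 * k) (n - k) =
      (-1) ^ (n - k) * a0 n k j := by
    rw [ext0, a0, Finset.mul_sum]
    simp only [smul_eq_mul, mul_ite, mul_one, mul_zero, binom_natCast]
    rw [← Finset.sum_filter]
    refine Finset.sum_subset_zero_on_sdiff ?_ ?_ fun _ _ => rfl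
    · intro l
      simp only [Finset.mem_filter, Finset.mem_range]
      omega
    · intro l hl
      simp only [Finset.mem_sdiff, Finset.mem_filter, Finset.mem_range] at hl
      rw [Nat.choose_eq_zero_of_lt (by omega), Nat.cast_zero, mul_zero]
  rw [show n + 1 - k = (n - k) + 1 by omega, ext0_succ', h1, ext0_add, h2, ext0_const]
  ring

lemma elemKernel_two_mul {n j : ℕ} (hj : j ≤ 2 * n) : elemKernel (2 * n) j = 0 := by
  rw [elemKernel, if_neg (by omega), Nat.mul_mod_right]
  simp

/-- The elementary part of the inverse between the even vertex `(i, i + 2m)` and the odd vertex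
`(j, j + 2q + 1)`. -/
def elemCross (i m j q : ℕ) : ℂ :=
  if i ≤ j ∧ j + q < i + m then (-1) ^ (m + q) * binom ((m : ℤ) - q - 1) (j - i) else 0

lemma elemCross_of_le {i m j q : ℕ} (h : m ≤ q) : elemCross i m j q = 0 := if_neg (by omega)

lemma elemCross_of_lt {i m j q : ℕ} (h : j < i) : elemCross i m j q = 0 := if_neg (by omega)

/-- The constraint `j + q < i + m` may be relaxed to `q < m`, as the binomial coefficient is `0` in
the remaining range. -/
lemma elemCross_add (i a q r : ℕ) :
    elemCross i (q + r + 1) (i + a) q = (-1) ^ (r + 1) * (r.choose a : ℂ) := by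
  have hs : (-1 : ℂ) ^ (q + r + 1 + q) = (-1) ^ (r + 1) := by
    rw [show q + r + 1 + q = 2 * q + (r + 1) by ring, pow_add, pow_mul]; norm_num
  rw [elemCross, hs, show ((q + r + 1 : ℕ) : ℤ) - q - 1 = (r : ℤ) by push_cast; ring,
    binom_natCast, show i + a - i = a by omega]
  split_ifs with h
  · rfl
  · rw [Nat.choose_eq_zero_of_lt (by omega), Nat.cast_zero, mul_zero]

lemma elemCross_odd_equation (i m j q : ℕ) :
    elemCross i (m + 1) j q + elemCross i m j q + elemCross (i + 1) m j q =
      -if i = j ∧ m = q then 1 else 0 := by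
  rcases lt_or_ge j i with hij | hij
  · rw [elemCross_of_lt hij, elemCross_of_lt hij, elemCross_of_lt (by omega), if_neg (by omega)]
    simp
  obtain ⟨a, rfl⟩ := Nat.exists_eq_add_of_le hij
  rcases lt_trichotomy m q with h | rfl | h
  · rw [elemCross_of_le (by omega), elemCross_of_le (by omega), elemCross_of_le (by omega),
      if_neg (by omega)]
    simp
  · rw [elemCross_of_le le_rfl, elemCross_of_le le_rfl]
    have := elemCross_add i a m 0
    rw [add_zero] at this
    rw [this]
    cases a with
    | zero => simp
    | succ a => simp
  · obtain ⟨r, rfl⟩ := Nat.exists_eq_add_of_lt h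
    rw [if_neg (by omega), elemCross_add, add_assoc q r 1, elemCross_add i a q (r + 1)]
    cases a with
    | zero => rw [elemCross_of_lt (by omega)]; simp [pow_succ]
    | succ a =>
      rw [show i + (a + 1) = i + 1 + a by ring, ← add_assoc q r 1, elemCross_add,
        Nat.choose_succ_succ']
      push_cast
      ring

lemma elemCross_even_equation (i m j q : ℕ) :
    elemCross j q i (m + 1) + elemCross j q (i + 1) (m + 1) + elemCross j q (i + 1) m =
      -if j = i + 1 ∧ q = m + 1 then 1 else 0 := by
  rcases lt_trichotomy j (i + 1) with hij | rfl | hij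
  · obtain ⟨a, rfl⟩ := Nat.exists_eq_add_of_le (Nat.lt_succ_iff.1 hij)
    rw [if_neg (by omega), add_assoc j a 1]
    rcases lt_trichotomy q (m + 1) with h | rfl | h
    · rw [elemCross_of_le (by omega), elemCross_of_le (by omega), elemCross_of_le (by omega)]
      simp
    · rw [elemCross_of_le le_rfl, elemCross_of_le le_rfl]
      have := elemCross_add j (a + 1) m 0
      rw [add_zero] at this
      rw [this]
      simp
    · obtain ⟨r, rfl⟩ := Nat.exists_eq_add_of_lt h
      rw [elemCross_add, elemCross_add, show m + 1 + r + 1 = m + (r + 1) + 1 by ring,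
        elemCross_add, Nat.choose_succ_succ']
      push_cast
      ring
  · rw [elemCross_of_lt (by omega)]
    rcases lt_trichotomy q (m + 1) with h | rfl | h
    · rw [elemCross_of_le (by omega), elemCross_of_le (by omega), if_neg (by omega)]
      simp
    · rw [elemCross_of_le le_rfl, if_pos ⟨rfl, rfl⟩]
      have := elemCross_add (i + 1) 0 m 0
      rw [add_zero, add_zero] at this
      rw [this]
      simp
    · obtain ⟨r, rfl⟩ := Nat.exists_eq_add_of_lt h
      have h1 := elemCross_add (i + 1) 0 (m + 1) r
      have h2 := elemCross_add (i + 1) 0 m (r + 1)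
      rw [show m + (r + 1) + 1 = m + 1 + r + 1 by ring] at h2
      rw [add_zero] at h1 h2
      rw [h1, h2, if_neg (by omega), Nat.choose_zero_right, Nat.choose_zero_right]
      push_cast
      ring
  · rw [elemCross_of_lt (by omega), elemCross_of_lt hij, elemCross_of_lt hij, if_neg (by omega)]
    simp

lemma elemCross_even_equation_zero (m j q : ℕ) :
    elemCross j q 0 (m + 1) + elemCross j q 0 m = -if j = 0 ∧ q = m + 1 then 1 else 0 := by
  rcases Nat.eq_zero_or_pos j with rfl | hj
  · rcases lt_trichotomy q (m + 1) with h | rfl | h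
    · rw [elemCross_of_le (by omega), elemCross_of_le (by omega), if_neg (by omega)]
      simp
    · rw [elemCross_of_le le_rfl, if_pos ⟨rfl, rfl⟩]
      have := elemCross_add 0 0 m 0
      rw [add_zero, add_zero] at this
      rw [this]
      simp
    · obtain ⟨r, rfl⟩ := Nat.exists_eq_add_of_lt h
      have h1 := elemCross_add 0 0 (m + 1) r
      have h2 := elemCross_add 0 0 m (r + 1)
      rw [show m + (r + 1) + 1 = m + 1 + r + 1 by ring] at h2
      rw [add_zero] at h1 h2
      rw [h1, h2, if_neg (by omega), Nat.choose_zero_right, Nat.choose_zero_right]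
      push_cast
      ring
  · rw [elemCross_of_lt hj, elemCross_of_lt hj, if_neg (by omega)]
    simp

lemma ext0_single (c j q : ℕ) :
    ext0 (fun b => if b = c then (1 : ℂ) else 0) j q =
      if j ≤ c then (-1) ^ q * (q.choose (c - j) : ℂ) else 0 := by
  rw [ext0]
  split_ifs with h
  · simp only [smul_eq_mul, mul_ite, mul_one, mul_zero]
    have : ∀ l ∈ Finset.range (q + 1), (if j + l = c then (-1) ^ q * binom q l else 0) =
        if l = c - j then (-1) ^ q * (q.choose l : ℂ) else 0 := by
      intro l _
      rw [binom_natCast]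
      by_cases h1 : j + l = c
      · rw [if_pos h1, if_pos (by omega)]
      · rw [if_neg h1, if_neg (by omega)]
    rw [Finset.sum_congr rfl this, Finset.sum_ite_eq' _ (c - j)]
    split_ifs with h2
    · rfl
    · rw [Finset.mem_range] at h2
      rw [Nat.choose_eq_zero_of_lt (by omega), Nat.cast_zero, mul_zero]
  · refine Finset.sum_eq_zero fun l _ => ?_
    rw [if_neg (by omega), smul_zero]

lemma elemCross_diag_equation (i j q : ℕ) :
    -elemCross j q i 0 - elemCross j q (i + 1) 0 +
      ext0 (fun b => if b = i + 1 then (1 : ℂ) else 0) j q =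
      if j = i + 1 ∧ q = 0 then 1 else 0 := by
  rw [ext0_single]
  cases q with
  | zero =>
    rw [elemCross_of_le le_rfl, elemCross_of_le le_rfl]
    rcases lt_trichotomy j (i + 1) with h | rfl | h
    · rw [if_pos h.le, Nat.choose_eq_zero_of_lt (by omega), if_neg (by omega)]; simp
    · simp
    · rw [if_neg (by omega), if_neg (by omega)]; simp
  | succ r =>
    rw [if_neg (show ¬(j = i + 1 ∧ r + 1 = 0) by omega)]
    rcases lt_trichotomy j (i + 1) with h | rfl | h
    · obtain ⟨a, rfl⟩ := Nat.exists_eq_add_of_le (Nat.lt_succ_iff.1 h)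
      have h1 := elemCross_add j a 0 r
      have h2 := elemCross_add j (a + 1) 0 r
      rw [zero_add] at h1 h2
      rw [h1, add_assoc, h2, if_pos (by omega), Nat.add_sub_cancel_left, Nat.choose_succ_succ']
      push_cast
      ring
    · have h1 := elemCross_add (i + 1) 0 0 r
      rw [zero_add, add_zero] at h1
      rw [elemCross_of_lt (by omega), h1, if_pos le_rfl, Nat.sub_self, Nat.choose_zero_right,
        Nat.choose_zero_right]
      ring
    · rw [elemCross_of_lt (by omega), elemCross_of_lt (by omega), if_neg (by omega)]; simp

lemma elemCross_diag_equation_zero (j q : ℕ) :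
    -elemCross j q 0 0 + ext0 (fun b => if b = 0 then (1 : ℂ) else 0) j q =
      if j = 0 ∧ q = 0 then 1 else 0 := by
  rw [ext0_single]
  rcases Nat.eq_zero_or_pos j with rfl | hj
  · cases q with
    | zero => rw [elemCross_of_le le_rfl]; simp
    | succ r =>
      have h1 := elemCross_add 0 0 0 r
      rw [zero_add, add_zero] at h1
      rw [h1]
      simp
  · rw [elemCross_of_lt hj, if_neg (by omega), if_neg (by omega)]; simp

/-! ### The rows of the Kasteleyn matrix -/

lemma mem_vertices {n a c : ℕ} : (a, c) ∈ vertices n ↔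
    a ≤ 2 * n ∧ c ≤ 2 * n + 1 ∧ a ≤ c ∧ ¬(n % 2 = 1 ∧ a = 2 * n ∧ c = 2 * n + 1) := by
  simp only [vertices, Finset.mem_filter, Finset.mem_product, Finset.mem_range, Prod.mk.injEq,
    Nat.odd_iff]
  omega

lemma sum_indicator_mul (s : Finset (ℕ × ℕ)) (a c : ℕ) (g : ℕ × ℕ → ℂ) :
    ∑ w ∈ s, (if w.1 = a ∧ w.2 = c then 1 else 0) * g w = if (a, c) ∈ s then g (a, c) else 0 := by
  have : ∀ w : ℕ × ℕ, (w.1 = a ∧ w.2 = c) ↔ w = (a, c) := fun w => by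
    rw [Prod.ext_iff]
  simp only [this, ite_mul, one_mul, zero_mul, Finset.sum_ite_eq']

lemma k_apply (a c a' c' : ℕ) : k (a, c) (a', c') =
    if ((a + c) % 2 = 0 ∧ c = c' ∧ a = a' + 1) ∨
      ((a + c) % 2 = 0 ∧ (c' = c + 1 ∨ c = c' + 1) ∧ a = a') ∨
      (a = c ∧ a' = c' ∧ a = a' + 1) then 1 else 0 := by
  rw [k]
  by_cases h1 : (a + c) % 2 = 0 ∧ c = c' ∧ a = a' + 1
  · rw [if_pos h1, if_pos (Or.inl h1)]
  · rw [if_neg h1]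
    by_cases h2 : (a + c) % 2 = 0 ∧ (c' = c + 1 ∨ c = c' + 1) ∧ a = a'
    · rw [if_pos h2, if_pos (Or.inr (Or.inl h2))]
    · rw [if_neg h2]
      by_cases h3 : a = c ∧ a' = c' ∧ a = a' + 1
      · rw [if_pos h3, if_pos (Or.inr (Or.inr h3))]
      · rw [if_neg h3, if_neg (by tauto)]

lemma k_sub_odd (i m : ℕ) (w : ℕ × ℕ) :
    k (i, i + 2 * m + 1) w - k w (i, i + 2 * m + 1) =
    -((if w.1 = i + 1 ∧ w.2 = i + 1 + 2 * m then 1 else 0) +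
      (if w.1 = i ∧ w.2 = i + 2 * (m + 1) then 1 else 0) +
      (if w.1 = i ∧ w.2 = i + 2 * m then 1 else 0)) := by
  obtain ⟨a, c⟩ := w
  have h1 : k (i, i + 2 * m + 1) (a, c) = 0 := by
    rw [k_apply]
    exact if_neg (by omega)
  have h2 : k (a, c) (i, i + 2 * m + 1) =
      (if a = i + 1 ∧ c = i + 1 + 2 * m then (1 : ℂ) else 0) +
      (if a = i ∧ c = i + 2 * (m + 1) then (1 : ℂ) else 0) +
      (if a = i ∧ c = i + 2 * m then (1 : ℂ) else 0) := by
    rw [k_apply]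
    split_ifs <;> first | (exfalso; omega) | norm_num
  rw [h1, h2]
  ring

lemma k_sub_even (i m : ℕ) (w : ℕ × ℕ) :
    k (i + 1, i + 1 + 2 * (m + 1)) w - k w (i + 1, i + 1 + 2 * (m + 1)) =
    (if w.1 = i ∧ w.2 = i + 2 * (m + 1) + 1 then 1 else 0) +
      (if w.1 = i + 1 ∧ w.2 = i + 1 + 2 * (m + 1) + 1 then 1 else 0) +
      (if w.1 = i + 1 ∧ w.2 = i + 1 + 2 * m + 1 then 1 else 0) := by
  obtain ⟨a, c⟩ := w
  have h1 : k (i + 1, i + 1 + 2 * (m + 1)) (a, c) =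
      (if a = i ∧ c = i + 2 * (m + 1) + 1 then (1 : ℂ) else 0) +
      (if a = i + 1 ∧ c = i + 1 + 2 * (m + 1) + 1 then (1 : ℂ) else 0) +
      (if a = i + 1 ∧ c = i + 1 + 2 * m + 1 then (1 : ℂ) else 0) := by
    rw [k_apply]
    split_ifs <;> first | (exfalso; omega) | norm_num
  have h2 : k (a, c) (i + 1, i + 1 + 2 * (m + 1)) = 0 := by
    rw [k_apply]
    exact if_neg (by omega)
  rw [h1, h2]
  ring

lemma k_sub_even_zero (m : ℕ) (w : ℕ × ℕ) :
    k (0, 0 + 2 * (m + 1)) w - k w (0, 0 + 2 * (m + 1)) =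
    (if w.1 = 0 ∧ w.2 = 0 + 2 * (m + 1) + 1 then 1 else 0) +
      (if w.1 = 0 ∧ w.2 = 0 + 2 * m + 1 then 1 else 0) := by
  obtain ⟨a, c⟩ := w
  have h1 : k (0, 0 + 2 * (m + 1)) (a, c) =
      (if a = 0 ∧ c = 0 + 2 * (m + 1) + 1 then (1 : ℂ) else 0) +
      (if a = 0 ∧ c = 0 + 2 * m + 1 then (1 : ℂ) else 0) := by
    rw [k_apply]
    split_ifs <;> first | (exfalso; omega) | (norm_num; done) |
      (exfalso; simp only [and_false, or_false, false_or] at *; omega)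
  have h2 : k (a, c) (0, 0 + 2 * (m + 1)) = 0 := by
    rw [k_apply]
    exact if_neg (by omega)
  rw [h1, h2]
  ring

lemma k_sub_diag (i : ℕ) {w : ℕ × ℕ} (hw : w.1 ≤ w.2) :
    k (i + 1, i + 1 + 2 * 0) w - k w (i + 1, i + 1 + 2 * 0) =
    (if w.1 = i ∧ w.2 = i + 2 * 0 + 1 then 1 else 0) +
      (if w.1 = i + 1 ∧ w.2 = i + 1 + 2 * 0 + 1 then 1 else 0) +
      (if w.1 = i ∧ w.2 = i + 2 * 0 then 1 else 0) -
      (if w.1 = i + 2 ∧ w.2 = i + 2 + 2 * 0 then 1 else 0) := by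
  obtain ⟨a, c⟩ := w
  replace hw : a ≤ c := hw
  have h1 : k (i + 1, i + 1 + 2 * 0) (a, c) =
      (if a = i ∧ c = i + 2 * 0 + 1 then (1 : ℂ) else 0) +
      (if a = i + 1 ∧ c = i + 1 + 2 * 0 + 1 then (1 : ℂ) else 0) +
      (if a = i ∧ c = i + 2 * 0 then (1 : ℂ) else 0) := by
    rw [k_apply]
    split_ifs <;> first | (exfalso; omega) | norm_num
  have h2 : k (a, c) (i + 1, i + 1 + 2 * 0) =
      (if a = i + 2 ∧ c = i + 2 + 2 * 0 then (1 : ℂ) else 0) := by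
    rw [k_apply]
    split_ifs <;> first | (exfalso; omega) | norm_num
  rw [h1, h2]

lemma k_sub_diag_zero (w : ℕ × ℕ) : k (0, 0 + 2 * 0) w - k w (0, 0 + 2 * 0) =
    (if w.1 = 0 ∧ w.2 = 0 + 2 * 0 + 1 then 1 else 0) -
      (if w.1 = 1 ∧ w.2 = 1 + 2 * 0 then 1 else 0) := by
  obtain ⟨a, c⟩ := w
  have h1 : k (0, 0 + 2 * 0) (a, c) = (if a = 0 ∧ c = 0 + 2 * 0 + 1 then (1 : ℂ) else 0) := by
    rw [k_apply]
    split_ifs <;> first | (exfalso; omega) | (norm_num; done) |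
      (exfalso; simp only [and_false, or_false, false_or] at *; omega)
  have h2 : k (a, c) (0, 0 + 2 * 0) = (if a = 1 ∧ c = 1 + 2 * 0 then (1 : ℂ) else 0) := by
    rw [k_apply]
    split_ifs <;> first | (exfalso; omega) | norm_num
  rw [h1, h2]

/-- The conditions which make a function the column of the inverse Kasteleyn matrix for the vertex
`y`. Its values are `g0 i m` at the even vertex `(i, i + 2m)` and `g1 i m` at the odd vertex
`(i, i + 2m + 1)`. The function satisfies the local equations on the unbounded domain, vanishes at
the virtual vertices with second coordinate `2n + 2`, and satisfies one condition at the corner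
`(2n, 2n)` which depends on the parity of `n`. -/
structure IsColumn (n : ℕ) (y : ℕ × ℕ) (g0 g1 : ℕ → ℕ → ℂ) : Prop where
  odd : ∀ i m, g0 i (m + 1) + g0 i m + g0 (i + 1) m =
    -if y = (i, i + 2 * m + 1) then 1 else 0
  even : ∀ i m, g1 i (m + 1) + g1 (i + 1) (m + 1) + g1 (i + 1) m =
    if y = (i + 1, i + 1 + 2 * (m + 1)) then 1 else 0
  even_zero : ∀ m, g1 0 (m + 1) + g1 0 m = if y = (0, 0 + 2 * (m + 1)) then 1 else 0
  diag : ∀ i, g1 i 0 + g1 (i + 1) 0 + g0 i 0 - g0 (i + 2) 0 =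
    if y = (i + 1, i + 1 + 2 * 0) then 1 else 0
  diag_zero : g1 0 0 - g0 1 0 = if y = (0, 0 + 2 * 0) then 1 else 0
  top_even : ∀ k ≤ n, g0 (2 * k) (n + 1 - k) = 0
  top_odd : ∀ i m, i + 2 * m = 2 * n + 1 → g1 i m = 0
  corner_even : n % 2 = 0 → g0 (2 * n) 0 = -if y = (2 * n, 2 * n + 2 * 0 + 1) then 1 else 0
  corner_odd : n % 2 = 1 → g1 (2 * n) 0 + g0 (2 * n) 0 = 0

/-- Multiplication of the Kasteleyn matrix by a column. The terms of the local equations which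
leave the graph vanish, or cancel at the corner. -/
lemma IsColumn.sum_eq {n : ℕ} {y : ℕ × ℕ} {g0 g1 : ℕ → ℕ → ℂ} (h : IsColumn n y g0 g1)
    (hy : y ∈ vertices n) {G : ℕ × ℕ → ℂ} (hG0 : ∀ i m, G (i, i + 2 * m) = g0 i m)
    (hG1 : ∀ i m, G (i, i + 2 * m + 1) = g1 i m) {x : ℕ × ℕ} (hx : x ∈ vertices n) :
    ∑ w ∈ vertices n, (k x w - k w x) * G w = if x = y then 1 else 0 := by
  rw [if_congr (eq_comm : x = y ↔ y = x) rfl rfl]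
  obtain ⟨i, c⟩ := x
  rw [mem_vertices] at hx
  -- The value at the virtual vertex `(2n + 1, 2n + 1)`.
  have hcorner : g0 (2 * n + 1) 0 = -(if y = (2 * n, 2 * n + 2 * 0 + 1) then 1 else 0) -
      g0 (2 * n) 0 := by
    have h1 := h.odd (2 * n) 0
    have h2 := h.top_even n le_rfl
    rw [show n + 1 - n = 0 + 1 by omega] at h2
    rw [h2] at h1
    linear_combination h1
  rcases Nat.even_or_odd' (c - i) with ⟨m, hm | hm⟩
  · obtain rfl : c = i + 2 * m := by omega
    cases m with
    | succ m =>
      cases i with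
      | zero =>
        have h1 := h.even_zero m
        simp only [k_sub_even_zero, add_mul, Finset.sum_add_distrib, sum_indicator_mul]
        rw [if_pos (mem_vertices.2 (by omega)), if_pos (mem_vertices.2 (by omega)), hG1, hG1, h1]
      | succ i =>
        have h1 := h.even i m
        simp only [k_sub_even, add_mul, Finset.sum_add_distrib, sum_indicator_mul]
        rw [if_pos (mem_vertices.2 (by omega) : (i, i + 2 * (m + 1) + 1) ∈ vertices n),
          if_pos (mem_vertices.2 (by omega) : (i + 1, i + 1 + 2 * m + 1) ∈ vertices n),
          hG1, hG1, hG1, ← h1]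
        split_ifs with h2
        · rfl
        · rw [mem_vertices] at h2
          rw [h.top_odd (i + 1) (m + 1) (by omega)]
    | zero =>
      cases i with
      | zero =>
        have h1 := h.diag_zero
        simp only [k_sub_diag_zero, sub_mul, Finset.sum_sub_distrib, sum_indicator_mul]
        rw [if_pos (mem_vertices.2 (by omega)), hG1 0 0, hG0 1 0, ← h1]
        split_ifs with h2
        · rfl
        · rw [mem_vertices] at h2
          obtain rfl : n = 0 := by omega
          have h3 := h.corner_even rfl
          rw [mul_zero] at hcorner h3
          rw [hcorner, h3]
          ring
      | succ i =>
        have h1 := h.diag i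
        rw [Finset.sum_congr rfl fun w hw => by
          rw [k_sub_diag i ((mem_vertices (a := w.1) (c := w.2)).1 hw).2.2.1]]
        simp only [add_mul, sub_mul, Finset.sum_add_distrib, Finset.sum_sub_distrib,
          sum_indicator_mul]
        rw [if_pos (mem_vertices.2 (by omega) : (i, i + 2 * 0 + 1) ∈ vertices n),
          if_pos (mem_vertices.2 (by omega) : (i, i + 2 * 0) ∈ vertices n),
          hG1 i 0, hG1 (i + 1) 0, hG0 i 0, hG0 (i + 2) 0, ← h1]
        rcases (show i + 1 < 2 * n ∨ i + 1 = 2 * n by omega) with h2 | h2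
        · rw [if_pos (mem_vertices.2 (by omega)), if_pos (mem_vertices.2 (by omega))]
        · rw [if_neg (show (i + 2, i + 2 + 2 * 0) ∉ vertices n by rw [mem_vertices]; omega)]
          rw [← h2] at hcorner
          rcases Nat.mod_two_eq_zero_or_one n with hn | hn
          · have h3 := h.corner_even hn
            rw [← h2] at h3
            rw [if_pos (mem_vertices.2 (by omega)), hcorner, h3]
            ring
          · have h3 := h.corner_odd hn
            rw [← h2] at h3
            rw [if_neg (by rw [mem_vertices]; omega), hcorner, if_neg]
            · linear_combination -h3
            · rintro rfl
              rw [mem_vertices] at hy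
              omega
  · obtain rfl : c = i + 2 * m + 1 := by omega
    have h1 := h.odd i m
    simp only [k_sub_odd, neg_mul, add_mul, Finset.sum_neg_distrib, Finset.sum_add_distrib,
      sum_indicator_mul]
    rw [if_pos (mem_vertices.2 (by omega) : (i, i + 2 * m) ∈ vertices n), hG0, hG0, hG0]
    rcases (show i < 2 * n ∨ i = 2 * n by omega) with h2 | rfl
    · rw [if_pos (mem_vertices.2 (by omega) : (i + 1, i + 1 + 2 * m) ∈ vertices n)]
      by_cases h3 : (i, i + 2 * (m + 1)) ∈ vertices n
      · rw [if_pos h3]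
        linear_combination -h1
      · rw [if_neg h3]
        rw [mem_vertices] at h3
        obtain ⟨k, hk⟩ : ∃ k, i = 2 * k := ⟨n - m, by omega⟩
        have h5 := h.top_even k (by omega)
        rw [← hk, show n + 1 - k = m + 1 by omega] at h5
        linear_combination -h1 + h5
    · obtain rfl : m = 0 := by omega
      rw [if_neg (by rw [mem_vertices]; omega), if_neg (by rw [mem_vertices]; omega),
        h.corner_even (by omega)]
      ring

/-! ### The inverse Kasteleyn matrix -/

/-- The vector attached to a vertex, obtained by propagating the vectors `e0 n i` of `(i, i)` and
`e1 n i` of `(i, i + 1)` off the diagonal. -/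
def vec (n : ℕ) (x : ℕ × ℕ) : ℕ → ℂ :=
  if (x.2 - x.1) % 2 = 0 then ext0 (e0 n) x.1 ((x.2 - x.1) / 2)
  else ext1 (e1 n) x.1 ((x.2 - x.1) / 2)

/-- The elementary part of the inverse Kasteleyn matrix. It does not depend on `n`. -/
def elemPart (x y : ℕ × ℕ) : ℂ :=
  if (x.2 - x.1) % 2 = 0 then
    if (y.2 - y.1) % 2 = 0 then
      ext0 (fun a => ext0 (elemKernel a) y.1 ((y.2 - y.1) / 2)) x.1 ((x.2 - x.1) / 2)
    else elemCross x.1 ((x.2 - x.1) / 2) y.1 ((y.2 - y.1) / 2)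
  else
    if (y.2 - y.1) % 2 = 0 then -elemCross y.1 ((y.2 - y.1) / 2) x.1 ((x.2 - x.1) / 2)
    else 0

/-- The entries of the inverse Kasteleyn matrix. -/
def inverse (n : ℕ) (x y : ℕ × ℕ) : ℂ := form n (vec n x) (vec n y) + elemPart x y

lemma even_decode (i m : ℕ) : (i + 2 * m - i) % 2 = 0 ∧ (i + 2 * m - i) / 2 = m := by omega

lemma odd_decode (i m : ℕ) : ¬(i + 2 * m + 1 - i) % 2 = 0 ∧ (i + 2 * m + 1 - i) / 2 = m := by omega

lemma vec_even (n i m : ℕ) : vec n (i, i + 2 * m) = ext0 (e0 n) i m := by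
  simp only [vec, (even_decode i m).1, (even_decode i m).2, if_true]

lemma vec_odd (n i m : ℕ) : vec n (i, i + 2 * m + 1) = ext1 (e1 n) i m := by
  simp only [vec, (odd_decode i m).1, (odd_decode i m).2, if_false]

lemma elemPart_even_even (i m j q : ℕ) : elemPart (i, i + 2 * m) (j, j + 2 * q) =
    ext0 (fun a => ext0 (elemKernel a) j q) i m := by
  simp only [elemPart, (even_decode i m).1, (even_decode i m).2, (even_decode j q).1,
    (even_decode j q).2, if_true]

lemma elemPart_even_odd (i m j q : ℕ) : elemPart (i, i + 2 * m) (j, j + 2 * q + 1) =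
    elemCross i m j q := by
  simp only [elemPart, (even_decode i m).1, (even_decode i m).2, (odd_decode j q).1,
    (odd_decode j q).2, if_true, if_false]

lemma elemPart_odd_even (i m j q : ℕ) : elemPart (i, i + 2 * m + 1) (j, j + 2 * q) =
    -elemCross j q i m := by
  simp only [elemPart, (odd_decode i m).1, (odd_decode i m).2, (even_decode j q).1,
    (even_decode j q).2, if_true, if_false]

lemma elemPart_odd_odd (i m j q : ℕ) : elemPart (i, i + 2 * m + 1) (j, j + 2 * q + 1) = 0 := by
  simp only [elemPart, (odd_decode i m).1, (odd_decode j q).1, if_false]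

lemma ext1_e1_top {n i m : ℕ} (h : i + 2 * m = 2 * n + 1) {c : ℕ} (hc : c ≤ n + 1) :
    ext1 (e1 n) i m c = 0 := by
  cases c with
  | zero => exact ext1_e1_zero ..
  | succ k => rw [ext1_e1_succ, ext1_a1_eq_zero (by omega) h]

lemma form_ext1_e1_top {n i m : ℕ} (h : i + 2 * m = 2 * n + 1) (Y : ℕ → ℂ) :
    form n (ext1 (e1 n) i m) Y = 0 := by
  rw [form_congr (X' := 0) (fun c hc => ext1_e1_top h hc), map_zero, LinearMap.zero_apply]

lemma form_ext0_e0_boundary {n k : ℕ} (hk : k ≤ n) (Y : ℕ → ℂ) :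
    form n (ext0 (e0 n) (2 * k) (n + 1 - k)) Y =
      -(-1) ^ (n + 1 - k) * (Y (k + 1) + 2 ^ (n - k) * Y 0) := by
  rw [form_congr (X' := (-1 : ℂ) ^ (n + 1 - k) • bdry n k)
    (fun c hc => by rw [ext0_e0_boundary hk hc]; rfl), map_smul, LinearMap.smul_apply,
    form_bdry hk, smul_eq_mul]
  ring

lemma form_diag (n i : ℕ) (Y : ℕ → ℂ) : form n (e1 n i) Y + form n (e1 n (i + 1)) Y +
    form n (e0 n i) Y - form n (e0 n (i + 2)) Y = 0 := by
  rw [← e1_add_e1_add_e0, map_add, map_add, LinearMap.add_apply, LinearMap.add_apply, sub_self]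

lemma ext0_e0_last {n j q : ℕ} (h : j + q ≤ 2 * n) : ext0 (e0 n) j q (n + 1) = 0 := by
  rw [ext0_e0_succ, ext0_a0, Nat.sub_eq_zero_of_le h, Finset.sum_range_zero, mul_zero]

/-- The corner equation for odd `n`. -/
lemma form_e1_add_form_e0_corner {n : ℕ} (hn : n % 2 = 1) (Y : ℕ → ℂ) :
    form n (e1 n (2 * n)) Y + form n (e0 n (2 * n)) Y = 0 := by
  have h : Odd n := Nat.odd_iff.2 hn
  rw [form_e1_two_mul, form_e0_two_mul, if_neg (Nat.not_even_iff_odd.2 h), h.neg_one_pow]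
  ring

lemma pair_eq_even {j q i m : ℕ} : ((j, j + 2 * q) = (i, i + 2 * m)) ↔ (j = i ∧ q = m) := by
  rw [Prod.mk.injEq]; omega

lemma pair_eq_odd {j q i m : ℕ} :
    ((j, j + 2 * q + 1) = (i, i + 2 * m + 1)) ↔ (j = i ∧ q = m) := by
  rw [Prod.mk.injEq]; omega

lemma pair_ne {j q i m : ℕ} : (j, j + 2 * q) ≠ (i, i + 2 * m + 1) := by
  rw [Ne, Prod.mk.injEq]; omega

lemma ext0_elemKernel_sub (i j q : ℕ) :
    ext0 (elemKernel i) j q - ext0 (elemKernel (i + 2)) j q =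
      ext0 (fun b => if b = i + 1 then (1 : ℂ) else 0) j q := by
  rw [sub_eq_iff_eq_add, ← ext0_add]
  congr 1
  funext b
  rw [← elemKernel_sub]
  ring

lemma isColumn_even {n j q : ℕ} (hy : (j, j + 2 * q) ∈ vertices n) :
    IsColumn n (j, j + 2 * q) (fun i m => inverse n (i, i + 2 * m) (j, j + 2 * q))
      (fun i m => inverse n (i, i + 2 * m + 1) (j, j + 2 * q)) := by
  rw [mem_vertices] at hy
  simp only [inverse, vec_even, vec_odd, elemPart_even_even, elemPart_odd_even]
  set Y := ext0 (e0 n) j q with hY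
  constructor
  · intro i m
    rw [if_neg pair_ne, ext0_succ, ext0_succ (fun a => ext0 (elemKernel a) j q), map_neg, map_add,
      LinearMap.neg_apply, LinearMap.add_apply]
    ring
  · intro i m
    rw [if_congr pair_eq_even rfl rfl, ext1_succ_succ, map_neg, map_add,
      LinearMap.neg_apply, LinearMap.add_apply]
    linear_combination -elemCross_even_equation i m j q
  · intro m
    rw [if_congr pair_eq_even rfl rfl, ext1_zero_succ, map_neg, LinearMap.neg_apply]
    linear_combination -elemCross_even_equation_zero m j q
  · intro i
    rw [if_congr pair_eq_even rfl rfl]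
    simp only [ext0_zero, ext1_zero]
    linear_combination form_diag n i Y + elemCross_diag_equation i j q + ext0_elemKernel_sub i j q
  · rw [if_congr pair_eq_even rfl rfl]
    simp only [ext0_zero, ext1_zero]
    have h1 : -ext0 (elemKernel 1) j q = ext0 (fun b => if b = 0 then (1 : ℂ) else 0) j q := by
      rw [neg_eq_iff_add_eq_zero, ← ext0_add]
      refine Finset.sum_eq_zero fun l _ => ?_
      have h2 : elemKernel 1 (j + l) + (if j + l = 0 then (1 : ℂ) else 0) = 0 := by
        rw [← elemKernel_one, add_neg_cancel]
      simp only [h2, smul_zero]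
    rw [e1_zero_eq_e0_one]
    linear_combination elemCross_diag_equation_zero j q + h1
  · intro k hk
    have h1 : ext0 (fun a => ext0 (elemKernel a) j q) (2 * k) (n + 1 - k) =
        (-1) ^ (n + 1 - k) * (Y (k + 1) + 2 ^ (n - k) * Y 0) := by
      rw [ext0_ext0_comm, hY, ext0_e0_succ, ext0_apply]
      have h2 : (fun b => ext0 (fun a => elemKernel a b) (2 * k) (n + 1 - k)) =
          fun b => (-1) ^ (n + 1 - k) * (a0 n k b + 2 ^ (n - k) * e0 n b 0) :=
        funext (ext0_elemKernel_boundary hk)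
      rw [h2]
      simp only [ext0, Finset.mul_sum, smul_eq_mul,
        ← Finset.sum_add_distrib]
      exact Finset.sum_congr rfl fun l _ => by ring
    rw [form_ext0_e0_boundary hk, h1]
    ring
  · intro i m h
    rw [form_ext1_e1_top h, elemCross, if_neg (by omega)]
    simp
  · intro hn
    have h1 : ext0 (elemKernel (2 * n)) j q = 0 :=
      Finset.sum_eq_zero fun l hl => by
        rw [Finset.mem_range] at hl
        rw [elemKernel_two_mul (by omega), smul_zero]
    rw [if_neg (pair_ne (m := 0)), ext0_zero, ext0_zero, h1, form_e0_two_mul,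
      if_pos (Nat.even_iff.2 hn), hY, ext0_e0_last (by omega)]
    simp
  · intro hn
    have h1 : ext0 (elemKernel (2 * n)) j q = 0 :=
      Finset.sum_eq_zero fun l hl => by
        rw [Finset.mem_range] at hl
        rw [elemKernel_two_mul (by omega), smul_zero]
    rw [ext1_zero, ext0_zero, ext0_zero, h1, elemCross, if_neg (by omega)]
    linear_combination form_e1_add_form_e0_corner hn Y

lemma isColumn_odd {n j q : ℕ} (hy : (j, j + 2 * q + 1) ∈ vertices n) :
    IsColumn n (j, j + 2 * q + 1) (fun i m => inverse n (i, i + 2 * m) (j, j + 2 * q + 1))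
      (fun i m => inverse n (i, i + 2 * m + 1) (j, j + 2 * q + 1)) := by
  rw [mem_vertices] at hy
  simp only [inverse, vec_even, vec_odd, elemPart_even_odd, elemPart_odd_odd]
  set Y := ext1 (e1 n) j q with hY
  constructor
  · intro i m
    have h1 : (j = i ∧ q = m) ↔ (i = j ∧ m = q) := by omega
    rw [if_congr (pair_eq_odd.trans h1) rfl rfl, ext0_succ, map_neg, map_add,
      LinearMap.neg_apply, LinearMap.add_apply]
    linear_combination elemCross_odd_equation i m j q
  · intro i m
    rw [if_neg pair_ne.symm, ext1_succ_succ, map_neg, map_add,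
      LinearMap.neg_apply, LinearMap.add_apply]
    ring
  · intro m
    rw [if_neg pair_ne.symm, ext1_zero_succ, map_neg, LinearMap.neg_apply]
    ring
  · intro i
    rw [if_neg pair_ne.symm, elemCross_of_le (Nat.zero_le q), elemCross_of_le (Nat.zero_le q)]
    simp only [ext0_zero, ext1_zero]
    linear_combination form_diag n i Y
  · rw [if_neg pair_ne.symm, elemCross_of_le (Nat.zero_le q)]
    simp only [ext0_zero, ext1_zero]
    rw [e1_zero_eq_e0_one]
    ring
  · intro k hk
    rw [form_ext0_e0_boundary hk, hY, ext1_e1_zero, ext1_e1_succ, ext1_a1 hk, elemCross]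
    by_cases h1 : 2 * k ≤ j
    · have h2 : (n : ℤ) - k - q = ((n - k - q : ℕ) : ℤ) := by omega
      rw [if_pos h1, show ((n + 1 - k : ℕ) : ℤ) - q - 1 = (n : ℤ) - k - q by omega, h2,
        binom_natCast]
      by_cases h3 : 2 * k ≤ j ∧ j + q < 2 * k + (n + 1 - k)
      · rw [if_pos h3]; ring
      · rw [if_neg h3, Nat.choose_eq_zero_of_lt (by omega)]; simp
    · rw [if_neg h1, if_neg (fun h => h1 h.1)]; ring
  · intro i m h
    rw [form_ext1_e1_top h, add_zero]
  · intro hn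
    rw [if_congr (pair_eq_odd (m := 0)) rfl rfl, ext0_zero, form_e0_two_mul,
      if_pos (Nat.even_iff.2 hn),
      elemCross_of_le (Nat.zero_le q), hY, ext1_e1_succ, ext1_a1 le_rfl]
    by_cases h1 : 2 * n ≤ j
    · obtain ⟨rfl, rfl⟩ : j = 2 * n ∧ q = 0 := by omega
      simp [binom_zero_right]
    · rw [if_neg h1, if_neg (by omega)]; simp
  · intro hn
    rw [ext1_zero, ext0_zero, elemCross_of_le (Nat.zero_le q)]
    linear_combination form_e1_add_form_e0_corner hn Y

lemma exists_decode {n : ℕ} {x : ℕ × ℕ} (hx : x ∈ vertices n) :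
    ∃ i m, x = (i, i + 2 * m) ∨ x = (i, i + 2 * m + 1) := by
  obtain ⟨i, c⟩ := x
  rw [mem_vertices] at hx
  refine ⟨i, (c - i) / 2, ?_⟩
  rw [Prod.mk.injEq, Prod.mk.injEq]
  omega

lemma K_mul_inverse (n : ℕ) :
    K n * (Matrix.of fun x y : vertices n => inverse n x y) = 1 := by
  ext x y
  have h1 : (K n * (Matrix.of fun x y : vertices n => inverse n x y)) x y =
      ∑ w ∈ vertices n, (k x w - k w x) * inverse n w y := by
    rw [Matrix.mul_apply]
    exact Finset.sum_coe_sort (vertices n) fun w => (k x w - k w x) * inverse n w y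
  rw [h1, Matrix.one_apply]
  obtain ⟨x, hx⟩ := x
  obtain ⟨y, hy⟩ := y
  simp only [Subtype.mk.injEq]
  obtain ⟨j, q, rfl | rfl⟩ := exists_decode hy
  · exact (isColumn_even hy).sum_eq hy (G := fun w => inverse n w (j, j + 2 * q))
      (fun _ _ => rfl) (fun _ _ => rfl) hx
  · exact (isColumn_odd hy).sum_eq hy (G := fun w => inverse n w (j, j + 2 * q + 1))
      (fun _ _ => rfl) (fun _ _ => rfl) hx

lemma K_inv_apply {n : ℕ} (x y : vertices n) : (K n)⁻¹ x y = inverse n x y := by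
  rw [Matrix.inv_eq_right_inv (K_mul_inverse n), Matrix.of_apply]

lemma isUnit_K (n : ℕ) : IsUnit (K n) :=
  IsUnit.of_mul_eq_one _ (K_mul_inverse n)

lemma K_inv_swap {n : ℕ} (x y : vertices n) : (K n)⁻¹ y x = -(K n)⁻¹ x y := by
  have h : (K n).transpose = -K n := by
    ext x y
    simp [K]
  have h1 : (-K n)⁻¹ = -(K n)⁻¹ :=
    Matrix.inv_eq_right_inv (by
      rw [neg_mul_neg, Matrix.mul_nonsing_inv _ ((Matrix.isUnit_iff_isUnit_det _).1 (isUnit_K n))])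
  have h2 := congrFun (congrFun (Matrix.transpose_nonsing_inv (K n)) x) y
  rw [h, h1] at h2
  exact h2

/-! ### The column of the vertex `𝐛` -/

lemma b_of_even {n : ℕ} (hn : n % 2 = 0) : (b n : ℕ × ℕ) = (2 * n, 2 * n + 2 * 0 + 1) := by
  simp [b, hn]

lemma b_of_odd {n : ℕ} (hn : n % 2 = 1) : (b n : ℕ × ℕ) = (2 * n, 2 * n + 2 * 0) := by
  simp [b, hn]

/-- Pairing with the vector of `𝐛` gives the functional which defines `h_n^{ε,𝐛}`; see `h0_eq` and
`h1_eq`. -/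
lemma form_vec_b {n : ℕ} {Y : ℕ → ℂ} (hY : Y (n + 1) = 0) :
    form n (vec n (b n)) Y = -(coord n 0 Y + coord n 1 Y) := by
  rcases Nat.mod_two_eq_zero_or_one n with hn | hn
  · rw [b_of_even hn, vec_odd n (2 * n) 0, ext1_zero, form_e1_two_mul, hY,
      (Nat.even_iff.2 hn).neg_one_pow]
    ring
  · rw [b_of_odd hn, vec_even n (2 * n) 0, ext0_zero, form_e0_two_mul, hY,
      if_neg (Nat.not_even_iff_odd.2 (Nat.odd_iff.2 hn))]
    ring

lemma inverse_b_odd {n i m : ℕ} (hi : i < 2 * n) :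
    inverse n (b n) (i, i + 2 * m + 1) =
      -(coord n 0 (ext1 (e1 n) i m) + coord n 1 (ext1 (e1 n) i m)) := by
  have h1 : elemPart (b n) (i, i + 2 * m + 1) = 0 := by
    rcases Nat.mod_two_eq_zero_or_one n with hn | hn
    · rw [b_of_even hn, elemPart_odd_odd (2 * n) 0]
    · rw [b_of_odd hn, elemPart_even_odd (2 * n) 0, elemCross_of_le (Nat.zero_le m)]
  rw [inverse, h1, add_zero, vec_odd, form_vec_b]
  rw [ext1_e1_succ, ext1_a1 le_rfl, if_neg (by omega)]

lemma inverse_b_even {n i m : ℕ} (hi : i < 2 * n) (hx : (i, i + 2 * m) ∈ vertices n) :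
    inverse n (b n) (i, i + 2 * m) =
      -(coord n 0 (ext0 (e0 n) i m) + coord n 1 (ext0 (e0 n) i m)) := by
  rw [mem_vertices] at hx
  have h1 : elemPart (b n) (i, i + 2 * m) = 0 := by
    rcases Nat.mod_two_eq_zero_or_one n with hn | hn
    · rw [b_of_even hn, elemPart_odd_even (2 * n) 0, elemCross, if_neg (by omega), neg_zero]
    · rw [b_of_odd hn, elemPart_even_even (2 * n) 0, ext0_zero]
      refine Finset.sum_eq_zero fun l hl => ?_
      rw [Finset.mem_range] at hl
      rw [elemKernel_two_mul (by omega), smul_zero]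
  rw [inverse, h1, add_zero, vec_even, form_vec_b (ext0_e0_last (by omega))]

end TSSCPP

end

theorem theorem3p2 (n : ℕ) (ρ : ℝ) (hρ₀ : 0 < ρ) (hρ₁ : ρ < 1) :
    -- the Kasteleyn matrix is invertible, and its inverse is antisymmetric
    IsUnit (TSSCPP.K n) ∧
    (∀ x y : TSSCPP.vertices n, (TSSCPP.K n)⁻¹ y x = -(TSSCPP.K n)⁻¹ x y) ∧
    -- both parities equal to one
    (∀ (x y : TSSCPP.vertices n) (i₁ i₂ j₁ j₂ : ℕ), i₁ < 2 * n → j₁ < 2 * n →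
      x.1 = (i₁, i₁ + 2 * i₂ + 1) → y.1 = (j₁, j₁ + 2 * j₂ + 1) →
      (TSSCPP.K n)⁻¹ x y =
        ∑ l₁ ∈ Finset.range (i₁ + 1), ∑ l₂ ∈ Finset.range (j₁ + 1),
          (-1) ^ (i₂ + j₂) * (-1) ^ (l₁ + l₂) *
            TSSCPP.binom ((i₂ : ℤ) - 1 + l₁) l₁ * TSSCPP.binom ((j₂ : ℤ) - 1 + l₂) l₂ *
            TSSCPP.t11 ρ n (i₁ - l₁) (j₁ - l₂)) ∧
    -- both parities equal to zero
    (∀ (x y : TSSCPP.vertices n) (i₁ i₂ j₁ j₂ : ℕ), i₁ < 2 * n → j₁ < 2 * n →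
      x.1 = (i₁, i₁ + 2 * i₂) → y.1 = (j₁, j₁ + 2 * j₂) →
      (TSSCPP.K n)⁻¹ x y =
        ∑ l₁ ∈ Finset.range (i₂ + 1), ∑ l₂ ∈ Finset.range (j₂ + 1),
          (-1) ^ (i₂ + j₂) * TSSCPP.binom i₂ l₁ * TSSCPP.binom j₂ l₂ *
            TSSCPP.t00 ρ n (i₁ + l₁) (j₁ + l₂)) ∧
    -- parities one and zero
    (∀ (x y : TSSCPP.vertices n) (i₁ i₂ j₁ j₂ : ℕ), i₁ < 2 * n → j₁ < 2 * n →
      x.1 = (i₁, i₁ + 2 * i₂ + 1) → y.1 = (j₁, j₁ + 2 * j₂) →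
      (TSSCPP.K n)⁻¹ x y =
        (∑ l₁ ∈ Finset.range (i₁ + 1), ∑ l₂ ∈ Finset.range (j₂ + 1),
          (-1) ^ (i₂ + j₂) * (-1) ^ l₁ *
            TSSCPP.binom ((i₂ : ℤ) - 1 + l₁) l₁ * TSSCPP.binom j₂ l₂ *
            TSSCPP.t10 ρ n (i₁ - l₁) (j₁ + l₂))
        - (if y.1.1 ≤ x.1.1 ∧ x.1.1 + x.1.2 < y.1.1 + y.1.2 then
            (-1) ^ (i₂ + j₂) * TSSCPP.binom ((j₂ : ℤ) - i₂ - 1) (i₁ - j₁) else 0)) ∧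
    -- parities zero and one
    (∀ (x y : TSSCPP.vertices n) (i₁ i₂ j₁ j₂ : ℕ), i₁ < 2 * n → j₁ < 2 * n →
      x.1 = (i₁, i₁ + 2 * i₂) → y.1 = (j₁, j₁ + 2 * j₂ + 1) →
      (TSSCPP.K n)⁻¹ x y =
        (∑ l₁ ∈ Finset.range (i₂ + 1), ∑ l₂ ∈ Finset.range (j₁ + 1),
          (-1) ^ (i₂ + j₂) * (-1) ^ l₂ *
            TSSCPP.binom i₂ l₁ * TSSCPP.binom ((j₂ : ℤ) - 1 + l₂) l₂ *
            TSSCPP.t01 ρ n (i₁ + l₁) (j₁ - l₂))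
        + (if x.1.1 ≤ y.1.1 ∧ y.1.1 + y.1.2 < x.1.1 + x.1.2 then
            (-1) ^ (i₂ + j₂) * TSSCPP.binom ((i₂ : ℤ) - j₂ - 1) (j₁ - i₁) else 0)) ∧
    -- the remaining entries, up to antisymmetry: the column of the vertex b
    (∀ (x : TSSCPP.vertices n) (i₁ i₂ : ℕ), i₁ < 2 * n → x.1 = (i₁, i₁ + 2 * i₂ + 1) →
      (TSSCPP.K n)⁻¹ x (TSSCPP.b n) =
        ∑ l ∈ Finset.range (i₁ + 1),
          (-1) ^ (i₂ + l) * TSSCPP.binom ((i₂ : ℤ) - 1 + l) l * TSSCPP.h1 ρ n (i₁ - l)) ∧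
    (∀ (x : TSSCPP.vertices n) (i₁ i₂ : ℕ), i₁ < 2 * n → x.1 = (i₁, i₁ + 2 * i₂) →
      (TSSCPP.K n)⁻¹ x (TSSCPP.b n) =
        ∑ l ∈ Finset.range (i₂ + 1),
          (-1) ^ i₂ * TSSCPP.binom i₂ l * TSSCPP.h0 ρ n (i₁ + l)) ∧
    -- and, for even n, the row of the vertex (2n, 2n)
    (Even n → ∀ x y : TSSCPP.vertices n, x.1 = (2 * n, 2 * n) →
      (TSSCPP.K n)⁻¹ x y = if y = TSSCPP.b n then -1 else 0) := by
  refine ⟨TSSCPP.isUnit_K n, TSSCPP.K_inv_swap, ?_, ?_, ?_, ?_, ?_, ?_, ?_⟩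
  · intro x y i₁ i₂ j₁ j₂ _ _ hx hy
    rw [TSSCPP.K_inv_apply, TSSCPP.inverse, hx, hy, TSSCPP.vec_odd, TSSCPP.vec_odd,
      TSSCPP.elemPart_odd_odd, add_zero]
    simp only [TSSCPP.ext1, TSSCPP.t11_eq hρ₀ hρ₁, map_sum, map_smul, LinearMap.sum_apply,
      LinearMap.smul_apply, smul_eq_mul, Finset.mul_sum]
    rw [Finset.sum_comm]
    exact Finset.sum_congr rfl fun _ _ => Finset.sum_congr rfl fun _ _ => by ring
  · intro x y i₁ i₂ j₁ j₂ _ _ hx hy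
    rw [TSSCPP.K_inv_apply, TSSCPP.inverse, hx, hy, TSSCPP.vec_even, TSSCPP.vec_even,
      TSSCPP.elemPart_even_even]
    simp only [TSSCPP.ext0, TSSCPP.t00_eq hρ₀ hρ₁, map_sum, map_smul, LinearMap.sum_apply,
      LinearMap.smul_apply, smul_eq_mul, Finset.mul_sum]
    rw [Finset.sum_comm]
    simp only [← Finset.sum_add_distrib]
    exact Finset.sum_congr rfl fun _ _ => Finset.sum_congr rfl fun _ _ => by ring
  · intro x y i₁ i₂ j₁ j₂ _ _ hx hy
    rw [TSSCPP.K_inv_apply, TSSCPP.inverse, hx, hy, TSSCPP.vec_odd, TSSCPP.vec_even,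
      TSSCPP.elemPart_odd_even, sub_eq_add_neg, TSSCPP.elemCross]
    congr 1
    · simp only [TSSCPP.ext0, TSSCPP.ext1, TSSCPP.t10_eq hρ₀ hρ₁, map_sum, map_smul,
        LinearMap.sum_apply, LinearMap.smul_apply, smul_eq_mul, Finset.mul_sum]
      rw [Finset.sum_comm]
      exact Finset.sum_congr rfl fun _ _ => Finset.sum_congr rfl fun _ _ => by ring
    · have h : (j₁ ≤ i₁ ∧ i₁ + i₂ < j₁ + j₂) ↔
          (j₁ ≤ i₁ ∧ i₁ + (i₁ + 2 * i₂ + 1) < j₁ + (j₁ + 2 * j₂)) := by omega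
      rw [add_comm j₂ i₂]
      exact congrArg Neg.neg (if_congr h rfl rfl)
  · intro x y i₁ i₂ j₁ j₂ _ _ hx hy
    rw [TSSCPP.K_inv_apply, TSSCPP.inverse, hx, hy, TSSCPP.vec_even, TSSCPP.vec_odd,
      TSSCPP.elemPart_even_odd, TSSCPP.elemCross]
    congr 1
    · simp only [TSSCPP.ext0, TSSCPP.ext1, TSSCPP.t01_eq hρ₀ hρ₁, map_sum, map_smul,
        LinearMap.sum_apply, LinearMap.smul_apply, smul_eq_mul, Finset.mul_sum]
      rw [Finset.sum_comm]
      exact Finset.sum_congr rfl fun _ _ => Finset.sum_congr rfl fun _ _ => by ring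
    · have h : (i₁ ≤ j₁ ∧ j₁ + j₂ < i₁ + i₂) ↔
          (i₁ ≤ j₁ ∧ j₁ + (j₁ + 2 * j₂ + 1) < i₁ + (i₁ + 2 * i₂)) := by omega
      exact if_congr h rfl rfl
  · intro x i₁ i₂ hi hx
    rw [TSSCPP.K_inv_swap, TSSCPP.K_inv_apply, hx, TSSCPP.inverse_b_odd hi, neg_neg,
      TSSCPP.map_ext1, TSSCPP.map_ext1, TSSCPP.ext1, TSSCPP.ext1, ← Finset.sum_add_distrib]
    refine Finset.sum_congr rfl fun l _ => ?_
    rw [TSSCPP.h1_eq hρ₀, smul_eq_mul, smul_eq_mul]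
    ring
  · intro x i₁ i₂ hi hx
    rw [TSSCPP.K_inv_swap, TSSCPP.K_inv_apply, hx, TSSCPP.inverse_b_even hi (hx ▸ x.2), neg_neg,
      TSSCPP.map_ext0, TSSCPP.map_ext0, TSSCPP.ext0, TSSCPP.ext0, ← Finset.sum_add_distrib]
    refine Finset.sum_congr rfl fun l _ => ?_
    rw [TSSCPP.h0_eq hρ₀ hρ₁, smul_eq_mul, smul_eq_mul]
    ring
  · intro hn x y hx
    have hn' : n % 2 = 0 := Nat.even_iff.1 hn
    have h1 : TSSCPP.inverse n (2 * n, 2 * n + 2 * 0) y =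
        -if (y : ℕ × ℕ) = (2 * n, 2 * n + 2 * 0 + 1) then 1 else 0 := by
      obtain ⟨y, hy⟩ := y
      obtain ⟨j, q, rfl | rfl⟩ := TSSCPP.exists_decode hy
      · exact (TSSCPP.isColumn_even hy).corner_even hn'
      · exact (TSSCPP.isColumn_odd hy).corner_even hn'
    rw [TSSCPP.K_inv_apply, hx]
    refine h1.trans ?_
    rw [← TSSCPP.b_of_even hn', if_congr Subtype.coe_inj rfl rfl]
    split_ifs <;> simp
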